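/- **Setting.** For $n,k\ge 1$ let $B^{(n)}_k$ be the classical crystal of $U'_q(A^{(1)}_{n-1})$ of the $k$-fold symmetric tensor representation: its elements are the single row tableaux $m_1\le\dots\le m_k$ on the letters $1,\dots,n$, equivalently the tuples $(x_1,\dots,x_n)\in\mathbb Z_{\ge0}^n$ with $\sum_i x_i=k$ ($x_i$ is the multiplicity of $i$). For $1\le i\le n-1$, $\tilde f_i$ replaces a letter $i$ by $i+1$ (and gives $0$ if there is no letter $i$); $\tilde f_0$ replaces a letter $n$ by $1$ (and gives $0$ if there is no letter $n$); $\tilde e_i$ is the reverse operation. Put $\varepsilon_i=x_{i+1}$, $\varphi_i=x_i$ for $1\le i\le n-1$, and $\varepsilon_0=x_1$, $\varphi_0=x_n$. On tensor products, $\tilde e_i(b_1\otimes b_2)=\tilde e_ib_1\otimes b_2$ if $\varphi_i(b_1)\ge\varepsilon_i(b_2)$ and $b_1\otimes\tilde e_ib_2$ otherwise; $\tilde f_i(b_1\otimes b_2)=\tilde f_ib_1\otimes b_2$ if $\varphi_i(b_1)>\varepsilon_i(b_2)$ and $b_1\otimes\tilde f_ib_2$ otherwise. The combinatorial $R$ matrix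 is the isomorphism $B^{(n)}_k\otimes B^{(n)}_l\to B^{(n)}_l\otimes B^{(n)}_k$, i.e. the bijection commuting with all $\tilde e_i,\tilde f_i$ ($0\le i\le n-1$); for $n=1$ it is the only map between the two one-element sets. Let $u_k$ be the tableau $1\cdots1$. Fix $M\ge1$, write $B_k=B^{(M+1)}_k$, $B'_k=B^{(M)}_k$, and let $R$, $R'$ be the corresponding combinatorial $R$ matrices. Let $\theta_n$ ($n\in\mathbb Z$) be positive integers. States are elements $p=\cdots\otimes p_n\otimes p_{n+1}\otimes\cdots$ with $p_n\in B_{\theta_n}$. If $p_n=u_{\theta_n}$ for all but finitely many $n$, then $T_\kappa(p)=\cdots\otimes q_n\otimes q_{n+1}\otimes\cdots$ is defined by $R(v_n\otimes p_n)=q_n\otimes v_{n+1}$ for all $n$, where $v_n\in B_\kappa$ and $v_n=u_\kappa$ for $n\ll0$ and for $n\gg0$. Number a line of cells by $\mathbb Z$ and cut it into consecutive boxes, box $n$ having $\theta_n$ cells. For $b\in B'_{k_1}$, $c\in B'_{k_2}$ a *two-soliton state with label $b\otimes c$* is obtained as follows: to $b=(m_1\le\dots\le m_{k_1})$ associate the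 word $m_{k_1}+1,\dots,m_1+1$, and similarly to $c$; place the word of $b$ and, to the right of it, the word of $c$ on consecutive cells each, put the letter $1$ into all other cells, and let $p_n\in B_{\theta_n}$ be the tableau of the letters in box $n$. It is *$D$-separated* if $s-r\ge D$, where $r$ is the box of the last cell of the first word and $s$ the box of the first cell of the second word. **Theorem.** For every $l$ there are constants $K$ and $D$, depending only on $l$, such that the following holds for all $M\ge1$, all $1\le k<l$, all sequences $(\theta_n)_{n\in\mathbb Z}$ of positive integers with $l>\theta_n$ for all but finitely many $n$, and all $\kappa\ge K$. There is exactly one map $S':B'_l\otimes B'_k\to B'_k\otimes B'_l$ such that for every $b\otimes c\in B'_l\otimes B'_k$ and every $D$-separated two-soliton state $p$ with label $b\otimes c$: 1. for every $D'$, the state $T_\kappa^t(p)$ is, for all sufficiently large $t$, a $D'$-separated two-soliton state with label $S'(b\otimes c)\in B'_k\otimes B'_l$ (so the soliton of amplitude $l$ has overtaken the one of amplitude $k$); 2. if for some $t\ge0$ the state $T_\kappa^t(p)$ is a $D$-separated two-soliton state with a label $c'\otimes b'\in B'_k\otimes B'_l$, then $c'\otimes b'=S'(b\otimes c)$. Moreover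 there is exactly one isomorphism of crystals $R':B'_l\otimes B'_k\to B'_k\otimes B'_l$, and $S'=R'$. -/

import Mathlib

open Filter

/-- The crystal of the `k`-fold symmetric tensor representation of `U'_q(A^{(1)}_{n-1})`: single row
semistandard tableaux of length `k` on `n` letters, recorded by the multiplicities of the letters.
The letters `1, …, n` are represented by the elements `0, …, n-1` of `Fin n`. -/
@[ext]
structure RowCrystal (n k : ℕ) where
  /-- the multiplicities `(x_1, …, x_n)` -/
  mult : Fin n → ℕ
  sum_mult : ∑ a, mult a = k

namespace RowCrystal

variable {n k l : ℕ}

theorem sum_move (b : RowCrystal n k) (i j : Fin n) (h : 0 < b.mult i) :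
    ∑ a, (b.mult a - (if a = i then 1 else 0) + (if a = j then 1 else 0)) = k := by
  have h1 : ∑ a, (b.mult a - (if a = i then 1 else 0)) + ∑ a, (if a = i then 1 else 0) = k := by
    rw [← Finset.sum_add_distrib]
    refine (Finset.sum_congr rfl fun a _ => ?_).trans b.sum_mult
    by_cases ha : a = i
    · subst ha
      simp only [if_true]
      omega
    · simp [ha]
  rw [Finset.sum_add_distrib]
  simp only [Finset.sum_ite_eq', Finset.mem_univ, if_true] at h1 ⊢
  exact h1

/-- Replace one letter `i` of the tableau by a letter `j`; `none` (the symbol `0` of crystal theory)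
if there is no letter `i`. -/
def move (i j : Fin n) (b : RowCrystal n k) : Option (RowCrystal n k) :=
  if h : 0 < b.mult i then
    some ⟨fun a => b.mult a - (if a = i then 1 else 0) + (if a = j then 1 else 0),
      b.sum_move i j h⟩
  else none

theorem iterate_move (i j : Fin n) (hij : i ≠ j) (m : ℕ) (b : RowCrystal n k) :
    (fun o : Option (RowCrystal n k) => o.bind (move i j))^[m] (some b) ≠ none ↔
      m ≤ b.mult i := by
  induction m generalizing b with
  | zero => simp
  | succ m ih =>
    rw [Function.iterate_succ_apply, Option.bind_some]
    by_cases h : 0 < b.mult i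
    · rw [move, dif_pos h, ih]
      simp only [if_true, if_neg hij]
      omega
    · rw [move, dif_neg h, Function.iterate_fixed (by rfl)]
      simp only [ne_eq, not_true_eq_false, false_iff]
      omega

variable [NeZero n]

/-- The Kashiwara operator `ẽ_i`, `i ∈ {0, …, n-1}` modulo `n`. In terms of the letters `1, …, n` it
turns a letter `i + 1` into `i` if `i ≠ 0`, and a letter `1` into `n` if `i = 0`; with letters
numbered from zero both cases read `i ↦ i - 1` modulo `n`. -/
def e (i : Fin n) (b : RowCrystal n k) : Option (RowCrystal n k) := move i (i - 1) b

/-- The Kashiwara operator `f̃_i`: it turns a letter `i` into `i + 1` if `i ≠ 0`, and `n` into `1` if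
`i = 0`. -/
def f (i : Fin n) (b : RowCrystal n k) : Option (RowCrystal n k) := move (i - 1) i b

/-- `ε_i(b)`, the multiplicity of the letter that `ẽ_i` changes; for `2 ≤ n` this is the largest `m`
with `ẽ_i^m b ≠ 0`, see `isGreatest_eps`. -/
def eps (i : Fin n) (b : RowCrystal n k) : ℕ := b.mult i

/-- `φ_i(b)`, the multiplicity of the letter that `f̃_i` changes; for `2 ≤ n` this is the largest `m`
with `f̃_i^m b ≠ 0`, see `isGreatest_phi`. -/
def phi (i : Fin n) (b : RowCrystal n k) : ℕ := b.mult (i - 1)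

theorem sub_one_ne (hn : 2 ≤ n) (i : Fin n) : i - 1 ≠ i := by
  intro h
  have h1 : (1 : Fin n) = 0 := by simpa using h
  have h2 := congrArg Fin.val h1
  rw [Fin.val_one', Nat.mod_eq_of_lt (by omega)] at h2
  simp at h2

theorem isGreatest_eps (hn : 2 ≤ n) (i : Fin n) (b : RowCrystal n k) :
    IsGreatest {m | (fun o : Option (RowCrystal n k) => o.bind (e i))^[m] (some b) ≠ none}
      (eps i b) := by
  have hi : i ≠ i - 1 := (sub_one_ne hn i).symm
  exact ⟨(iterate_move _ _ hi _ b).mpr le_rfl, fun m hm => (iterate_move _ _ hi m b).mp hm⟩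

theorem isGreatest_phi (hn : 2 ≤ n) (i : Fin n) (b : RowCrystal n k) :
    IsGreatest {m | (fun o : Option (RowCrystal n k) => o.bind (f i))^[m] (some b) ≠ none}
      (phi i b) := by
  have hi : i - 1 ≠ i := sub_one_ne hn i
  exact ⟨(iterate_move _ _ hi _ b).mpr le_rfl, fun m hm => (iterate_move _ _ hi m b).mp hm⟩

/-- The action of `ẽ_i` on the tensor product of two crystals. -/
def tensorE (i : Fin n) (x : RowCrystal n k × RowCrystal n l) :
    Option (RowCrystal n k × RowCrystal n l) :=
  if eps i x.2 ≤ phi i x.1 then (e i x.1).map fun b => (b, x.2)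
  else (e i x.2).map fun b => (x.1, b)

/-- The action of `f̃_i` on the tensor product of two crystals. -/
def tensorF (i : Fin n) (x : RowCrystal n k × RowCrystal n l) :
    Option (RowCrystal n k × RowCrystal n l) :=
  if eps i x.2 < phi i x.1 then (f i x.1).map fun b => (b, x.2)
  else (f i x.2).map fun b => (x.1, b)

/-- Isomorphisms of crystals `B_k ⊗ B_l ≅ B_l ⊗ B_k`: bijections that commute with all `ẽ_i`, `f̃_i`
(and send `0` to `0`). -/
def IsCrystalIso (Φ : RowCrystal n k × RowCrystal n l ≃ RowCrystal n l × RowCrystal n k) : Prop :=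
  ∀ (i : Fin n) (x : RowCrystal n k × RowCrystal n l),
    tensorE i (Φ x) = (tensorE i x).map Φ ∧ tensorF i (Φ x) = (tensorF i x).map Φ

instance : Nonempty (RowCrystal n k × RowCrystal n l ≃ RowCrystal n l × RowCrystal n k) :=
  ⟨Equiv.prodComm _ _⟩

/-- The combinatorial `R` matrix `B_k ⊗ B_l → B_l ⊗ B_k` of `U'_q(A^{(1)}_{n-1})`: the isomorphism of
crystals. For `n = 1` each crystal has a single element, and this is the only map there is. -/
noncomputable def combinatorialR (n k l : ℕ) [NeZero n] :
    RowCrystal n k × RowCrystal n l ≃ RowCrystal n l × RowCrystal n k :=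
  Classical.epsilon IsCrystalIso

/-- The highest weight element `u_k`, the tableau with all entries `1`. -/
def u (n k : ℕ) [NeZero n] : RowCrystal n k :=
  ⟨fun a => if a = 0 then k else 0, by simp⟩

/-- The entries of the tableau in weakly increasing order. -/
def row (b : RowCrystal n k) : List (Fin n) :=
  (List.finRange n).flatMap fun a => List.replicate (b.mult a) a

end RowCrystal

namespace Automaton

open RowCrystal

/-- States `⋯ ⊗ b_n ⊗ b_{n+1} ⊗ ⋯` with `b_n ∈ B_{θ_n}`, for `U'_q(A^{(1)}_M)`. -/
abbrev State (M : ℕ) (θ : ℤ → ℕ) : Type := (n : ℤ) → RowCrystal (M + 1) (θ n)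

instance (M : ℕ) (θ : ℤ → ℕ) : Nonempty (State M θ) := ⟨fun n => u (M + 1) (θ n)⟩

variable {M : ℕ} {θ : ℤ → ℕ}

/-- `u_κ ⊗ (⋯ ⊗ p_n ⊗ p_{n+1} ⊗ ⋯) ≃ (⋯ ⊗ q_n ⊗ q_{n+1} ⊗ ⋯) ⊗ u_κ` under successive application
of the combinatorial `R` matrices `v_n ⊗ p_n ↦ q_n ⊗ v_{n+1}`; the carrier `v` is `u_κ` far to the
left and far to the right. -/
def IsTimeEvolution (κ : ℕ) (p q : State M θ) : Prop :=
  ∃ v : ℤ → RowCrystal (M + 1) κ,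
    (∀ᶠ n in atBot, v n = u (M + 1) κ) ∧ (∀ᶠ n in atTop, v n = u (M + 1) κ) ∧
    ∀ n, combinatorialR (M + 1) κ (θ n) (v n, p n) = (q n, v (n + 1))

/-- The time evolution `T_κ`. -/
noncomputable def T (κ : ℕ) (p : State M θ) : State M θ :=
  Classical.epsilon (IsTimeEvolution κ p)

/-- The array of boxes is cut out of a line of cells numbered by `ℤ`: box `n` consists of the `θ_n`
cells `boxStart θ n ≤ j < boxStart θ (n + 1)`, and box `0` starts with cell `0`. -/
noncomputable def boxStart (θ : ℤ → ℕ) (n : ℤ) : ℤ :=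
  ∑ m ∈ Finset.Ico 0 n, (θ m : ℤ) - ∑ m ∈ Finset.Ico n 0, (θ m : ℤ)

theorem boxStart_succ (θ : ℤ → ℕ) (n : ℤ) : boxStart θ (n + 1) = boxStart θ n + θ n := by
  unfold boxStart
  rcases le_or_gt 0 n with h | h
  · rw [Finset.Ico_eq_empty (show ¬ n < 0 by omega),
      Finset.Ico_eq_empty (show ¬ n + 1 < 0 by omega)]
    have : Finset.Ico 0 (n + 1) = insert n (Finset.Ico 0 n) := by
      ext a; simp only [Finset.mem_Ico, Finset.mem_insert]; omega
    rw [this, Finset.sum_insert (by simp)]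
    simp; ring
  · rw [Finset.Ico_eq_empty (show ¬ 0 < n by omega),
      Finset.Ico_eq_empty (show ¬ 0 < n + 1 by omega)]
    have : Finset.Ico n 0 = insert n (Finset.Ico (n + 1) 0) := by
      ext a; simp only [Finset.mem_Ico, Finset.mem_insert]; omega
    rw [this, Finset.sum_insert (by simp)]
    simp

/-- The map `θ̂`: group a sequence of elements of `B_1`, one for each cell, into the boxes, and put the
letters of each box into weakly increasing order. -/
noncomputable def group (θ : ℤ → ℕ) (w : ℤ → Fin (M + 1)) : State M θ := fun n =>
  ⟨fun a => ((Finset.Ico (boxStart θ n) (boxStart θ n + θ n)).filter fun j => w j = a).card, by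
    rw [← Finset.card_eq_sum_card_fiberwise (fun _ _ => by simp)]
    simp⟩

/-- The map `ı_k`: the tableau `m_1 ≤ ⋯ ≤ m_k` on the letters `1, …, M` goes to the word
`m_k + 1, …, m_1 + 1`. -/
def solitonWord {k : ℕ} (b : RowCrystal M k) : List (Fin (M + 1)) :=
  b.row.reverse.map Fin.succ

/-- The infinite word `⋯ 1 1 w 1 1 ⋯`, in which `w` starts at cell `x`. -/
def place (x : ℤ) (w : List (Fin (M + 1))) (j : ℤ) : Fin (M + 1) :=
  if j < x then 0 else w.getD (j - x).toNat 0

/-- The state `ι_{k₁,k₂}(b₁ ⊗ b₂)` on the infinite array of boxes: two words associated with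
`b₁ ∈ B'_{k₁}` and `b₂ ∈ B'_{k₂}`, the first one starting at cell `x`, separated by `L` letters `1`. -/
noncomputable def twoSoliton (θ : ℤ → ℕ) {k₁ k₂ : ℕ} (x : ℤ) (L : ℕ) (b : RowCrystal M k₁ × RowCrystal M k₂) :
    State M θ :=
  group θ (place x (solitonWord b.1 ++ List.replicate L 0 ++ solitonWord b.2))

/-- `p` is a two soliton state `ι_{k₁,k₂}(b₁ ⊗ b₂)` in which the first soliton lies in boxes up to
number `r`, the second one in boxes from number `s` on, and `s - r ≥ D`. For large `D` this is an
asymptotic two soliton state, with solitons labelled by `b₁` (on the left) and `b₂`. -/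
def IsSeparated (θ : ℤ → ℕ) (D : ℕ) {k₁ k₂ : ℕ} (b : RowCrystal M k₁ × RowCrystal M k₂)
    (p : State M θ) : Prop :=
  ∃ (x : ℤ) (L : ℕ) (r s : ℤ), p = twoSoliton θ x L b ∧
    x + k₁ ≤ boxStart θ (r + 1) ∧ boxStart θ s ≤ x + k₁ + L ∧ r + D ≤ s

/-- `S` is the scattering matrix `B'_l ⊗ B'_k → B'_k ⊗ B'_l` under the time evolution `T_κ` of asymptotic
two soliton states, namely those with `D`-separated solitons. Every incoming state with label `b`
becomes a two soliton state with label `S b` in the opposite order, the solitons being separated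
by any prescribed distance from some time on; and at no time `t` is there a transition from an
asymptotic state with label `b` to one with a label in `B'_k ⊗ B'_l` other than `S b`. -/
def IsScatteringMatrix (θ : ℤ → ℕ) (κ D : ℕ) {l k : ℕ}
    (S : RowCrystal M l × RowCrystal M k → RowCrystal M k × RowCrystal M l) : Prop :=
  ∀ (b : RowCrystal M l × RowCrystal M k) (p : State M θ), IsSeparated θ D b p →
    (∀ D' : ℕ, ∀ᶠ t : ℕ in atTop, IsSeparated θ D' (S b) ((T κ)^[t] p)) ∧
    ∀ (t : ℕ) (c : RowCrystal M k × RowCrystal M l),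
      IsSeparated θ D c ((T κ)^[t] p) → c = S b

end Automaton

/-! A collision is solved exactly by an ultradiscrete two-soliton tau function, whose bilinear
equation holds because the labels on its two sides are related by the combinatorial R matrix.

The R matrix has a piecewise linear form, `explicitR`, built from minima of differences of partial
sums over one period. It commutes with `f̃_i` because the two letters that `f̃_i` involves see all
the others only through a single number (`explicitR_local`). It is the only morphism because the
highest weight elements for `i ≠ 0` are told apart by `φ_1`, which every morphism preserves
(`IsMorphism.eq`).

If the carrier has room for all letters other than the lowest one, R becomes an exchange rule. For
the number `F n a` of letters greater than `a` in the boxes up to `n`, one time step is then a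
max-plus recursion (`HasProfile.timeEvolution`). Put `F n a = τ_M - τ_a` with `τ_a = max(0, ξ - β_a,
ζ - γ_a, ξ + ζ - δ_a)`. Here `β_a` counts letters of the first factor of `b ⊗ c`, `γ_a` letters of
the first factor of `R(b ⊗ c)`, and `δ_a` letters of both factors plus a constant. The phases `ξ`,
`ζ` grow by `min(θ_n, l)`, `min(θ_n, k)` from box to box and drop by `l`, `k` at each time step. The
recursion is now the bilinear equation `tau_bilinear`; its hypothesis on the labels is the recursion
`explicitR_fst_eq_min` for R.

The same tau function splits into two one-soliton counts in two regimes: with labels `b ⊗ c` if `ξ`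
is large wherever `ζ` matters, and with labels `R(b ⊗ c)` in the opposite case. As `θ_n < l` for
almost all `n`, the quantity `l ζ - k ξ` grows strictly to the right, so the second regime is
eventually reached (`eventually_phase_ge`). Every sufficiently separated state, incoming or
outgoing, has a tau function, and a separated state determines its label; both clauses of the
theorem follow. -/

namespace RowCrystal

/-! ### Partial sums and the piecewise linear R matrix. -/

variable {n k l p q : ℕ}

/-- The number of letters smaller than `i`, as an integer. -/
def psum (x : Fin n → ℕ) (i : ℕ) : ℤ := ∑ j, if j.val < i then (x j : ℤ) else 0

theorem psum_zero (x : Fin n → ℕ) : psum x 0 = 0 := by simp [psum]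

theorem psum_of_le (b : RowCrystal n k) {i : ℕ} (h : n ≤ i) : psum b.mult i = k := by
  have : ∀ j : Fin n, j.val < i := fun j => j.2.trans_le h
  simp only [psum, this, if_true]
  exact_mod_cast b.sum_mult

theorem psum_succ (x : Fin n → ℕ) (j : Fin n) : psum x (j.val + 1) = psum x j.val + x j := by
  have h : ∀ a : Fin n, (if a.val < j.val + 1 then (x a : ℤ) else 0)
      = (if a.val < j.val then (x a : ℤ) else 0) + if a = j then (x a : ℤ) else 0 := by
    intro a
    by_cases h1 : a = j
    · subst h1; simp
    · have h2 : a.val ≠ j.val := fun h => h1 (Fin.ext h)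
      simp only [h1, if_false, add_zero]
      exact if_congr (by omega) rfl rfl
  simp only [psum, h, Finset.sum_add_distrib, Finset.sum_ite_eq', Finset.mem_univ, if_true]

theorem psum_mono (x : Fin n → ℕ) {i j : ℕ} (h : i ≤ j) : psum x i ≤ psum x j := by
  refine Finset.sum_le_sum fun a _ => ?_
  split_ifs <;> omega

theorem psum_nonneg (x : Fin n → ℕ) (i : ℕ) : 0 ≤ psum x i := by
  rw [← psum_zero x]
  exact psum_mono x (Nat.zero_le _)

/-- The effect on partial sums of replacing a letter `a` by a letter `b`. -/
theorem psum_replace {x y : Fin n → ℕ} {a b : Fin n}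
    (h : ∀ j, y j + (if j = a then 1 else 0) = x j + if j = b then 1 else 0) (i : ℕ) :
    psum y i + (if a.val < i then 1 else 0) = psum x i + if b.val < i then 1 else 0 := by
  have hs : ∀ c : Fin n, (if c.val < i then (1 : ℤ) else 0)
      = ∑ j : Fin n, if j = c then (if j.val < i then (1 : ℤ) else 0) else 0 := by
    intro c; simp
  rw [hs a, hs b, psum, psum, ← Finset.sum_add_distrib, ← Finset.sum_add_distrib]
  refine Finset.sum_congr rfl fun j _ => ?_
  have := h j
  split_ifs at this ⊢ <;> omega

/-- The difference of the partial sums of `x ⊗ y` around the letter `j`. -/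
def gap (x y : Fin n → ℕ) (j : Fin n) : ℤ := psum x j.val - psum y (j.val + 1)

theorem gap_succ (x y : Fin n → ℕ) (j : Fin n) (h : j.val + 1 < n) :
    gap x y ⟨j.val + 1, h⟩ = gap x y j + x j - y ⟨j.val + 1, h⟩ := by
  have := psum_succ x j
  have := psum_succ y ⟨j.val + 1, h⟩
  simp only [gap] at *
  omega

theorem move_eq_some_iff {i j : Fin n} (hij : i ≠ j) {b c : RowCrystal n k} :
    move i j b = some c ↔
      ∀ a, c.mult a + (if a = i then 1 else 0) = b.mult a + if a = j then 1 else 0 := by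
  unfold move
  constructor
  · intro h
    split_ifs at h with h0
    obtain rfl := Option.some.inj h
    intro a
    by_cases ha : a = i
    · subst ha; simp [hij]; omega
    · simp [ha]
  · intro h
    have h0 : 0 < b.mult i := by
      have := h i
      simp only [if_true, if_neg hij] at this
      omega
    rw [dif_pos h0]
    congr 1
    ext a
    have := h a
    by_cases ha : a = i
    · subst ha; simp [hij] at this ⊢; omega
    · simp [ha] at this ⊢; omega

theorem move_eq_none_iff {i j : Fin n} {b : RowCrystal n k} :
    move i j b = none ↔ b.mult i = 0 := by
  unfold move
  split_ifs with h <;> simp <;> omega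

variable [NeZero n]

/-- The minimum over one period, starting at the cut `i`, of a sequence that increases by `c` over
one period. -/
def cutMin (g : Fin n → ℤ) (c : ℤ) (i : ℕ) : ℤ :=
  Finset.univ.inf' Finset.univ_nonempty fun j => g j + if j.val < i then c else 0

theorem cutMin_le (g : Fin n → ℤ) (c : ℤ) (i : ℕ) (j : Fin n) :
    cutMin g c i ≤ g j + if j.val < i then c else 0 :=
  Finset.inf'_le _ (Finset.mem_univ j)

theorem exists_cutMin_eq (g : Fin n → ℤ) (c : ℤ) (i : ℕ) :
    ∃ j, cutMin g c i = g j + if j.val < i then c else 0 := by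
  obtain ⟨j, -, h⟩ := Finset.exists_mem_eq_inf' (Finset.univ_nonempty (α := Fin n))
    fun j => g j + if j.val < i then c else 0
  exact ⟨j, h⟩

theorem cutMin_top (g : Fin n → ℤ) (c : ℤ) : cutMin g c n = cutMin g c 0 + c := by
  obtain ⟨i, hi⟩ := exists_cutMin_eq g c n
  obtain ⟨j, hj⟩ := exists_cutMin_eq g c 0
  have h1 := cutMin_le g c n j
  have h2 := cutMin_le g c 0 i
  simp only [Fin.is_lt, if_true, Nat.not_lt_zero, if_false] at *
  omega

/-- The piecewise linear function that governs the combinatorial `R` matrix. -/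
def cut (z : RowCrystal n k × RowCrystal n l) (i : ℕ) : ℤ :=
  cutMin (gap z.1.mult z.2.mult) ((k : ℤ) - l) i

theorem cut_top (z : RowCrystal n k × RowCrystal n l) : cut z n = cut z 0 + (k - l) :=
  cutMin_top _ _

/-- Extend `gap` quasi-periodically with increment `k - l`; then `cut z i` is its minimum over the
window of length `n` starting at `i`. Moving the window one step to the right loses only the entry
at `j`, and the next entry exceeds that one by at most the multiplicity of `j` in the first factor.
This inequality and the next make the entries of `explicitR` nonnegative. -/
theorem cut_succ_le (z : RowCrystal n k × RowCrystal n l) (j : Fin n) :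
    cut z (j.val + 1) ≤ z.1.mult j + cut z j.val := by
  obtain ⟨i, hi⟩ := exists_cutMin_eq (gap z.1.mult z.2.mult) ((k : ℤ) - l) j.val
  have h1 := cutMin_le (gap z.1.mult z.2.mult) ((k : ℤ) - l) (j.val + 1) i
  by_cases hij : i = j
  · subst hij
    by_cases h : i.val + 1 < n
    · have h2 := cutMin_le (gap z.1.mult z.2.mult) ((k : ℤ) - l) (i.val + 1) ⟨i.val + 1, h⟩
      have h3 := gap_succ z.1.mult z.2.mult i h
      simp only [cut, lt_irrefl, if_false] at *
      omega
    -- For the last letter, the next entry of the window is that of the letter 0, raised by one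
    -- period.
    · have h2 := cutMin_le (gap z.1.mult z.2.mult) ((k : ℤ) - l) (i.val + 1) 0
      have h3 := psum_succ z.1.mult i
      have h4 := psum_of_le z.1 (not_lt.1 h)
      have h5 := psum_of_le z.2 (not_lt.1 h)
      have h6 := psum_nonneg z.2.mult 1
      have h7 := psum_zero z.1.mult
      simp only [cut, gap, lt_irrefl, if_false, Fin.val_zero, Nat.succ_pos, if_true, zero_add] at *
      omega
  · have : i.val ≠ j.val := fun h => hij (Fin.ext h)
    simp only [cut] at *
    split_ifs at * <;> omega

/-- The mirror image: the window moves to the left, and the entry that it loses is compared with its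
left neighbour. -/
theorem cut_le_succ (z : RowCrystal n k × RowCrystal n l) (j : Fin n) :
    cut z j.val ≤ z.2.mult j + cut z (j.val + 1) := by
  obtain ⟨i, hi⟩ := exists_cutMin_eq (gap z.1.mult z.2.mult) ((k : ℤ) - l) (j.val + 1)
  have h1 := cutMin_le (gap z.1.mult z.2.mult) ((k : ℤ) - l) j.val i
  by_cases hij : i = j
  · subst hij
    rcases Nat.eq_zero_or_pos i.val with h | h
    · have hn : n - 1 < n := Nat.sub_lt (NeZero.pos n) one_pos
      have h2 := cutMin_le (gap z.1.mult z.2.mult) ((k : ℤ) - l) i.val ⟨n - 1, hn⟩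
      have h3 := psum_succ z.2.mult i
      have h4 := psum_of_le z.1 le_rfl
      have h5 := psum_of_le z.2 (show n ≤ n - 1 + 1 by omega)
      have h6 := psum_mono z.1.mult hn.le
      have h7 := psum_zero z.1.mult
      have h8 := psum_zero z.2.mult
      simp only [cut, gap, h, Nat.succ_pos, if_true, Nat.not_lt_zero, if_false] at *
      omega
    · have h2 := cutMin_le (gap z.1.mult z.2.mult) ((k : ℤ) - l) i.val ⟨i.val - 1, by omega⟩
      have h3 := psum_succ z.2.mult i
      have h6 := psum_mono z.1.mult (show i.val - 1 ≤ i.val by omega)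
      have h7 : i.val - 1 + 1 = i.val := by omega
      have h8 : i.val - 1 < i.val := by omega
      simp only [cut, gap, h7, h8, Nat.lt_succ_self, if_true] at *
      omega
  · have : i.val ≠ j.val := fun h => hij (Fin.ext h)
    simp only [cut] at *
    split_ifs at * <;> omega

theorem sum_cut_sub (z : RowCrystal n k × RowCrystal n l) :
    ∑ j : Fin n, (cut z (j.val + 1) - cut z j.val) = k - l := by
  rw [Fin.sum_univ_eq_sum_range (fun i => cut z (i + 1) - cut z i), Finset.sum_range_sub, cut_top]
  ring

/-- The explicit form of the combinatorial `R` matrix. -/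
def explicitR (z : RowCrystal n k × RowCrystal n l) : RowCrystal n l × RowCrystal n k :=
  (⟨fun j => (z.1.mult j - cut z (j.val + 1) + cut z j.val).toNat, by
      have h : ∀ j, (((z.1.mult j - cut z (j.val + 1) + cut z j.val).toNat : ℕ) : ℤ)
          = z.1.mult j - (cut z (j.val + 1) - cut z j.val) := fun j => by
        have := cut_succ_le z j; omega
      zify
      simp only [h, Finset.sum_sub_distrib]
      rw [← Finset.sum_sub_distrib, sum_cut_sub, ← Nat.cast_sum, z.1.sum_mult]
      ring⟩,
    ⟨fun j => (z.2.mult j + cut z (j.val + 1) - cut z j.val).toNat, by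
      have h : ∀ j, (((z.2.mult j + cut z (j.val + 1) - cut z j.val).toNat : ℕ) : ℤ)
          = z.2.mult j + (cut z (j.val + 1) - cut z j.val) := fun j => by
        have := cut_le_succ z j; omega
      zify
      simp only [h, Finset.sum_add_distrib]
      rw [sum_cut_sub, ← Nat.cast_sum, z.2.sum_mult]
      ring⟩)

theorem explicitR_fst (z : RowCrystal n k × RowCrystal n l) (j : Fin n) :
    ((explicitR z).1.mult j : ℤ) = z.1.mult j - cut z (j.val + 1) + cut z j.val := by
  have := cut_succ_le z j
  simp only [explicitR]
  omega

theorem explicitR_snd (z : RowCrystal n k × RowCrystal n l) (j : Fin n) :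
    ((explicitR z).2.mult j : ℤ) = z.2.mult j + cut z (j.val + 1) - cut z j.val := by
  have := cut_le_succ z j
  simp only [explicitR]
  omega

/-! ### Tensor product operators in terms of multiplicities -/

theorem tensorF_eq_some_iff (hn : 2 ≤ n) {i : Fin n} {z w : RowCrystal n k × RowCrystal n l} :
    tensorF i z = some w ↔
      (z.2.mult i < z.1.mult (i - 1) ∧ w.2 = z.2 ∧ ∀ a, w.1.mult a + (if a = i - 1 then 1 else 0)
        = z.1.mult a + if a = i then 1 else 0) ∨
      (z.1.mult (i - 1) ≤ z.2.mult i ∧ w.1 = z.1 ∧ ∀ a, w.2.mult a + (if a = i - 1 then 1 else 0)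
        = z.2.mult a + if a = i then 1 else 0) := by
  have hi := sub_one_ne hn i
  unfold tensorF eps phi f
  split_ifs with h
  · simp only [h, true_and, not_le.2 h, false_and, or_false, Option.map_eq_some_iff,
      move_eq_some_iff hi]
    constructor
    · rintro ⟨a, h1, rfl⟩
      exact ⟨rfl, h1⟩
    · rintro ⟨h1, h2⟩
      exact ⟨w.1, h2, by rw [← h1]⟩
  · simp only [h, false_and, not_lt.1 h, true_and, false_or, Option.map_eq_some_iff,
      move_eq_some_iff hi]
    constructor
    · rintro ⟨a, h1, rfl⟩
      exact ⟨rfl, h1⟩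
    · rintro ⟨h1, h2⟩
      exact ⟨w.2, h2, by rw [← h1]⟩

theorem tensorE_eq_some_iff (hn : 2 ≤ n) {i : Fin n} {z w : RowCrystal n k × RowCrystal n l} :
    tensorE i z = some w ↔ tensorF i w = some z := by
  have hi := sub_one_ne hn i
  rw [tensorF_eq_some_iff hn]
  unfold tensorE eps phi e
  split_ifs with h
  · simp only [Option.map_eq_some_iff, move_eq_some_iff hi.symm]
    constructor
    · rintro ⟨a, h1, rfl⟩
      refine Or.inl ⟨?_, rfl, fun a => (h1 a).symm⟩
      have := h1 (i - 1)
      simp only [if_neg hi, if_true] at this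
      dsimp only
      omega
    · rintro (⟨h1, h2, h3⟩ | ⟨h1, h2, h3⟩)
      · exact ⟨w.1, fun a => (h3 a).symm, by rw [h2]⟩
      · have := h3 i
        simp only [if_neg hi.symm, if_true] at this
        rw [h2] at h
        omega
  · simp only [Option.map_eq_some_iff, move_eq_some_iff hi.symm]
    constructor
    · rintro ⟨a, h1, rfl⟩
      refine Or.inr ⟨?_, rfl, fun a => (h1 a).symm⟩
      have := h1 i
      simp only [if_neg hi.symm, if_true] at this
      dsimp only
      omega
    · rintro (⟨h1, h2, h3⟩ | ⟨h1, h2, h3⟩)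
      · have := h3 (i - 1)
        simp only [if_neg hi, if_true] at this
        rw [h2] at h
        omega
      · exact ⟨w.2, fun a => (h3 a).symm, by rw [h2]⟩

theorem tensorF_eq_none_iff {i : Fin n} {z : RowCrystal n k × RowCrystal n l} :
    tensorF i z = none ↔ z.1.mult (i - 1) ≤ z.2.mult i ∧ z.2.mult (i - 1) = 0 := by
  unfold tensorF eps phi f
  split_ifs with h <;> simp only [Option.map_eq_none_iff, move_eq_none_iff] <;> omega

theorem tensorE_eq_none_iff {i : Fin n} {z : RowCrystal n k × RowCrystal n l} :
    tensorE i z = none ↔ z.2.mult i ≤ z.1.mult (i - 1) ∧ z.1.mult i = 0 := by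
  unfold tensorE eps phi e
  split_ifs with h <;> simp only [Option.map_eq_none_iff, move_eq_none_iff] <;> omega

theorem sub_one_val (i : Fin n) (h : i ≠ 0) : (i - 1).val + 1 = i.val := by
  have h1 := Fin.val_sub_one_of_ne_zero h
  have h2 : i.val ≠ 0 := fun h' => h (Fin.ext (by simpa using h'))
  omega

theorem zero_sub_one_val : ((0 : Fin n) - 1).val + 1 = n := by
  obtain ⟨m, rfl⟩ := Nat.exists_eq_succ_of_ne_zero (NeZero.ne n)
  rw [zero_sub, Fin.coe_neg_one]

end RowCrystal

/-! ### Compatibility of the piecewise linear R matrix with the Kashiwara operators. -/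

namespace RowCrystal

variable {n k l p q : ℕ} [NeZero n]

/-- Subscripts 1 and 0 stand for the letters `i - 1` and `i`, `x ⊗ y` is mapped to `u ⊗ v`, and
primes mark the situation after `f̃_i` has acted on the first factor. Since `a < b`, lowering `b` by
one affects only the middle minimum. If `b` attains it, the change passes to the second factor of
the image; otherwise it stays in the first. -/
theorem localForm_step_fst {x₁ x₀ y₁ y₀ u₁ u₀ v₁ v₀ u₁' u₀' v₁' v₀' a b c W : ℤ}
    (hz : u₁ + min (a + c) (min b W) = x₁ + min a (min b W) ∧
      v₁ + min a (min b W) = y₁ + min (a + c) (min b W) ∧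
      u₀ + min (a + c) (min (b + c) W) = x₀ + min (a + c) (min b W) ∧
      v₀ + min (a + c) (min b W) = y₀ + min (a + c) (min (b + c) W))
    (hw : u₁' + min (a + c) (min (b - 1) W) = x₁ - 1 + min a (min (b - 1) W) ∧
      v₁' + min a (min (b - 1) W) = y₁ + min (a + c) (min (b - 1) W) ∧
      u₀' + min (a + c) (min (b - 1 + c) W) = x₀ + 1 + min (a + c) (min (b - 1) W) ∧
      v₀' + min (a + c) (min (b - 1) W) = y₀ + min (a + c) (min (b - 1 + c) W))
    (hg : b = a + x₁ - y₀) (h : y₀ < x₁) :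
    (v₀ < u₁ ∧ v₀' = v₀ ∧ v₁' = v₁ ∧ u₁' + 1 = u₁ ∧ u₀' = u₀ + 1) ∨
      (u₁ ≤ v₀ ∧ u₀' = u₀ ∧ u₁' = u₁ ∧ v₁' + 1 = v₁ ∧ v₀' = v₀ + 1) := by
  have e1 : min a (min b W) = min a W := by clear hz hw; omega
  have e2 : min a (min (b - 1) W) = min a W := by clear hz hw; omega
  have e3 : min (a + c) (min (b + c) W) = min (a + c) W := by clear hz hw; omega
  have e4 : min (a + c) (min (b - 1 + c) W) = min (a + c) W := by clear hz hw; omega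
  rw [e1, e3] at hz
  rw [e2, e4] at hw
  by_cases hb : b ≤ a + c ∧ b ≤ W
  · rw [show min (a + c) (min b W) = b by clear hz hw; omega] at hz
    rw [show min (a + c) (min (b - 1) W) = b - 1 by clear hz hw; omega] at hw
    right
    clear e1 e2 e3 e4
    refine ⟨?_, ?_, ?_, ?_, ?_⟩ <;> omega
  · rw [show min (a + c) (min b W) = min (a + c) W by clear hz hw; omega] at hz
    rw [show min (a + c) (min (b - 1) W) = min (a + c) W by clear hz hw; omega] at hw
    left
    clear e1 e2 e3 e4
    refine ⟨?_, ?_, ?_, ?_, ?_⟩ <;> omega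

/-- The case in which `f̃_i` acts on the second factor. Now `b ≤ a`, and raising `a` by one changes
the middle minimum only if `a + c` is its strict minimum. -/
theorem localForm_step_snd {x₁ x₀ y₁ y₀ u₁ u₀ v₁ v₀ u₁' u₀' v₁' v₀' a b c W : ℤ}
    (hz : u₁ + min (a + c) (min b W) = x₁ + min a (min b W) ∧
      v₁ + min a (min b W) = y₁ + min (a + c) (min b W) ∧
      u₀ + min (a + c) (min (b + c) W) = x₀ + min (a + c) (min b W) ∧
      v₀ + min (a + c) (min b W) = y₀ + min (a + c) (min (b + c) W))
    (hw : u₁' + min (a + 1 + c) (min b W) = x₁ + min (a + 1) (min b W) ∧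
      v₁' + min (a + 1) (min b W) = y₁ - 1 + min (a + 1 + c) (min b W) ∧
      u₀' + min (a + 1 + c) (min (b + c) W) = x₀ + min (a + 1 + c) (min b W) ∧
      v₀' + min (a + 1 + c) (min b W) = y₀ + 1 + min (a + 1 + c) (min (b + c) W))
    (hg : b = a + x₁ - y₀) (h : x₁ ≤ y₀) :
    (v₀ < u₁ ∧ v₀' = v₀ ∧ v₁' = v₁ ∧ u₁' + 1 = u₁ ∧ u₀' = u₀ + 1) ∨
      (u₁ ≤ v₀ ∧ u₀' = u₀ ∧ u₁' = u₁ ∧ v₁' + 1 = v₁ ∧ v₀' = v₀ + 1) := by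
  have e1 : min a (min b W) = min b W := by clear hz hw; omega
  have e3 : min (a + c) (min (b + c) W) = min (b + c) W := by clear hz hw; omega
  rw [e1, e3] at hz
  by_cases hb : b ≤ a
  · have e2 : min (a + 1) (min b W) = min b W := by clear hz hw; omega
    have e4 : min (a + 1 + c) (min (b + c) W) = min (b + c) W := by clear hz hw; omega
    rw [e2, e4] at hw
    clear e1 e2 e3 e4
    by_cases hb : a + c < b ∧ a + c < W
    · rw [show min (a + c) (min b W) = a + c by clear hz hw; omega] at hz
      rw [show min (a + 1 + c) (min b W) = a + 1 + c by clear hz hw; omega] at hw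
      left
      refine ⟨?_, ?_, ?_, ?_, ?_⟩ <;> omega
    · rw [show min (a + c) (min b W) = min b W by clear hz hw; omega] at hz
      rw [show min (a + 1 + c) (min b W) = min b W by clear hz hw; omega] at hw
      right
      refine ⟨?_, ?_, ?_, ?_, ?_⟩ <;> omega
  · exact absurd (by clear hz hw; omega) hb

/-- `W` is the minimum of `T` over the other letters. If there are none, `W = B` serves, as the
bound `S i ≤ B + s` makes it irrelevant. One `W` works for all `S` of this kind, so that the minima
before and after `f̃_i` can be compared. -/
theorem exists_inf'_eq_min (i i' : Fin n) (T : Fin n → ℤ) (B : ℤ) :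
    ∃ W : ℤ, ∀ (S : Fin n → ℤ) (s : ℤ), (∀ j, j ≠ i → j ≠ i' → S j = T j + s) → S i ≤ B + s →
      Finset.univ.inf' Finset.univ_nonempty S = min (S i) (min (S i') (W + s)) := by
  by_cases h : ∃ j, j ≠ i ∧ j ≠ i'
  · have hT : (Finset.univ.filter fun j : Fin n => j ≠ i ∧ j ≠ i').Nonempty := by
      simpa [Finset.filter_nonempty_iff] using h
    refine ⟨Finset.inf' _ hT T, fun S s hS _ => le_antisymm ?_ ?_⟩
    · obtain ⟨j, hj, hW⟩ := Finset.exists_mem_eq_inf' hT T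
      simp only [Finset.mem_filter, Finset.mem_univ, true_and] at hj
      rw [hW, ← hS j hj.1 hj.2]
      exact le_min (Finset.inf'_le _ (Finset.mem_univ _))
        (le_min (Finset.inf'_le _ (Finset.mem_univ _)) (Finset.inf'_le _ (Finset.mem_univ _)))
    · refine Finset.le_inf' _ _ fun j _ => ?_
      by_cases h1 : j = i
      · rw [h1]; exact min_le_left _ _
      by_cases h2 : j = i'
      · rw [h2]; exact (min_le_right _ _).trans (min_le_left _ _)
      have := Finset.inf'_le T (show j ∈ Finset.univ.filter fun j => j ≠ i ∧ j ≠ i' by simp [h1, h2])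
      have := hS j h1 h2
      omega
  · push Not at h
    refine ⟨B, fun S s _ hB => le_antisymm ?_ ?_⟩
    · have h1 := Finset.inf'_le S (Finset.mem_univ i)
      have h2 := Finset.inf'_le S (Finset.mem_univ i')
      exact le_min h1 (le_min h2 (h1.trans hB))
    · refine Finset.le_inf' _ _ fun j _ => ?_
      by_cases h1 : j = i
      · rw [h1]; exact min_le_left _ _
      · rw [h j h1]; exact (min_le_right _ _).trans (min_le_left _ _)

/-- The relation between the gaps at cyclically adjacent letters. -/
theorem gap_sub_one (z : RowCrystal n k × RowCrystal n l) (i : Fin n) :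
    gap z.1.mult z.2.mult i + (if i = 0 then (k : ℤ) - l else 0)
      = gap z.1.mult z.2.mult (i - 1) + z.1.mult (i - 1) - z.2.mult i := by
  by_cases h : i = 0
  · subst h
    have h1 := psum_succ z.1.mult (0 - 1)
    have h2 := psum_succ z.2.mult (0 : Fin n)
    have h5 := psum_zero z.1.mult
    have h6 := psum_zero z.2.mult
    rw [zero_sub_one_val, psum_of_le z.1 le_rfl] at h1
    simp only [gap, zero_sub_one_val, psum_of_le z.2 le_rfl, if_true, Fin.val_zero] at *
    omega
  · have h1 := psum_succ z.1.mult (i - 1)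
    have h2 := psum_succ z.2.mult i
    simp only [gap, sub_one_val i h, if_neg h] at *
    omega

/-- The local form of the combinatorial `R` matrix at a pair of cyclically adjacent letters: it
depends on the other letters only through the number `W`. -/
theorem explicitR_local (hn : 2 ≤ n) (z : RowCrystal n k × RowCrystal n l) (i : Fin n) :
    ∃ W : ℤ, ∀ (z' : RowCrystal n k × RowCrystal n l) (s a b c : ℤ),
      (∀ j, j ≠ i - 1 → j ≠ i → gap z'.1.mult z'.2.mult j = gap z.1.mult z.2.mult j + s) →
      gap z'.1.mult z'.2.mult (i - 1) ≤ gap z.1.mult z.2.mult (i - 1) + s + 1 →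
      a = gap z'.1.mult z'.2.mult (i - 1) - s →
      b = gap z'.1.mult z'.2.mult i - s + (if i = 0 then c else 0) → c = k - l →
      ((explicitR z').1.mult (i - 1) : ℤ) + min (a + c) (min b W)
        = z'.1.mult (i - 1) + min a (min b W) ∧
      ((explicitR z').2.mult (i - 1) : ℤ) + min a (min b W)
        = z'.2.mult (i - 1) + min (a + c) (min b W) ∧
      ((explicitR z').1.mult i : ℤ) + min (a + c) (min (b + c) W)
        = z'.1.mult i + min (a + c) (min b W) ∧
      ((explicitR z').2.mult i : ℤ) + min (a + c) (min b W)
        = z'.2.mult i + min (a + c) (min (b + c) W) := by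
  have hi := sub_one_ne hn i
  -- The bound leaves room for a growth of the gap by one and for the period shifts between the
  -- windows. If `i = 0`, all other letters lie before the window that starts at `n - 1`, hence
  -- carry the period.
  obtain ⟨W, hW⟩ := exists_inf'_eq_min (i - 1) i
    (fun j => gap z.1.mult z.2.mult j + if j.val < i.val ∨ i = 0 then (k : ℤ) - l else 0)
    (gap z.1.mult z.2.mult (i - 1) + 1 + 2 * |(k : ℤ) - l|)
  have habs := le_abs_self ((k : ℤ) - l)
  have habs' := neg_abs_le ((k : ℤ) - l)
  refine ⟨W, fun z' s a b c hS hB ha hb hc => ?_⟩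
  rw [explicitR_fst, explicitR_snd, explicitR_fst, explicitR_snd]
  by_cases h : i = 0
  · subst h
    have hv : ((0 : Fin n) - 1).val + 1 = n := zero_sub_one_val
    simp only [if_true] at hb
    simp only [or_true, if_true] at hW
    have e1 : cut z' (0 - 1 : Fin n).val = min a (min b W) + s := by
      refine (hW _ s (fun j h1 h2 => ?_) ?_).trans ?_
      · have h3 : j.val < (0 - 1 : Fin n).val := by
          have := j.2
          have : j.val ≠ (0 - 1 : Fin n).val := fun h => h1 (Fin.ext h)
          omega
        rw [hS j h1 h2, if_pos h3]; ring
      · simp only [lt_irrefl, if_false]; omega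
      · have h3 : (0 : Fin n).val < (0 - 1 : Fin n).val := by simp only [Fin.val_zero]; omega
        simp only [lt_irrefl, if_false, if_pos h3]; omega
    have e2 : cut z' n = min (a + c) (min b W) + s := by
      refine (hW _ s (fun j h1 h2 => ?_) ?_).trans ?_
      · rw [hS j h1 h2, if_pos j.2]; ring
      · rw [if_pos (Fin.is_lt _)]; omega
      · rw [if_pos (Fin.is_lt _), if_pos (Fin.is_lt _)]; omega
    -- The window after the one at `n` is the window at 1, shifted by a whole period; hence the
    -- offset `s - c`.
    have e3 : cut z' 1 + c = min (a + c) (min (b + c) W) + s := by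
      have : cut z' 1 = _ := hW _ (s - c) (fun j h1 h2 => ?_) ?_
      · rw [this, if_neg (by omega), if_pos (by simp)]; omega
      · have : j.val ≠ 0 := fun h => h2 (Fin.ext (by simpa using h))
        rw [hS j h1 h2, if_neg (by omega)]; omega
      · rw [if_neg (by omega)]; omega
    have e4 := cut_top z'
    rw [hv, Fin.val_zero, zero_add, e1]
    omega
  · have hv := sub_one_val i h
    simp only [h, if_false, or_false] at hb hW
    have e1 : cut z' (i - 1).val = min a (min b W) + s := by
      refine (hW _ s (fun j h1 h2 => ?_) ?_).trans ?_
      · have : j.val ≠ (i - 1).val := fun h => h1 (Fin.ext h)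
        rw [hS j h1 h2]
        split_ifs <;> omega
      · simp only [lt_irrefl, if_false]; omega
      · rw [if_neg (by omega), if_neg (by omega)]; omega
    have e2 : cut z' i.val = min (a + c) (min b W) + s := by
      refine (hW _ s (fun j h1 h2 => ?_) ?_).trans ?_
      · rw [hS j h1 h2]; ring
      · rw [if_pos (by omega)]; omega
      · rw [if_pos (by omega), if_neg (by omega)]; omega
    have e3 : cut z' (i.val + 1) = min (a + c) (min (b + c) W) + s := by
      refine (hW _ s (fun j h1 h2 => ?_) ?_).trans ?_
      · have : j.val ≠ i.val := fun h => h2 (Fin.ext h)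
        rw [hS j h1 h2]
        split_ifs <;> omega
      · rw [if_pos (by omega)]; omega
      · rw [if_pos (by omega), if_pos (by omega)]; omega
    rw [hv, e1, e2, e3]
    omega

/-- The effect of `f̃_i` on the gaps. -/
theorem gap_tensorF (hn : 2 ≤ n) {i : Fin n} {z w : RowCrystal n k × RowCrystal n l}
    (h : tensorF i z = some w) :
    ∃ s : ℤ, (∀ j, j ≠ i - 1 → j ≠ i →
        gap w.1.mult w.2.mult j = gap z.1.mult z.2.mult j + s) ∧
      ((z.2.mult i < z.1.mult (i - 1) ∧
          gap w.1.mult w.2.mult (i - 1) = gap z.1.mult z.2.mult (i - 1) + s ∧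
          gap w.1.mult w.2.mult i = gap z.1.mult z.2.mult i + s - 1) ∨
        (z.1.mult (i - 1) ≤ z.2.mult i ∧
          gap w.1.mult w.2.mult (i - 1) = gap z.1.mult z.2.mult (i - 1) + s + 1 ∧
          gap w.1.mult w.2.mult i = gap z.1.mult z.2.mult i + s)) := by
  have hi := sub_one_ne hn i
  rcases (tensorF_eq_some_iff hn).1 h with ⟨h1, h2, h3⟩ | ⟨h1, h2, h3⟩
  · have hp := psum_replace h3
    by_cases h0 : i = 0
    · subst h0
      have hv : ((0 : Fin n) - 1).val + 1 = n := zero_sub_one_val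
      refine ⟨1, fun j hj hj' => ?_, Or.inl ⟨h1, ?_, ?_⟩⟩
      · have := hp j.val
        have h0 : j.val ≠ 0 := fun h => hj' (Fin.ext (by simpa using h))
        rw [if_neg (by omega), if_pos (by simp only [Fin.val_zero]; omega)] at this
        simp only [gap, h2]; omega
      · have := hp (0 - 1 : Fin n).val
        rw [if_neg (by omega), if_pos (by simp only [Fin.val_zero]; omega)] at this
        simp only [gap, h2]; omega
      · simp only [gap, h2, Fin.val_zero, psum_zero]; omega
    · have hv := sub_one_val i h0
      refine ⟨0, fun j hj hj' => ?_, Or.inl ⟨h1, ?_, ?_⟩⟩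
      · have := hp j.val
        have : j.val ≠ i.val := fun h => hj' (Fin.ext h)
        simp only [gap, h2]
        split_ifs at * <;> omega
      · have := hp (i - 1).val
        rw [if_neg (by omega), if_neg (by omega)] at this
        simp only [gap, h2]; omega
      · have := hp i.val
        rw [if_pos (by omega), if_neg (by omega)] at this
        simp only [gap, h2]; omega
  · have hp := psum_replace h3
    by_cases h0 : i = 0
    · subst h0
      have hv : ((0 : Fin n) - 1).val + 1 = n := zero_sub_one_val
      refine ⟨-1, fun j hj hj' => ?_, Or.inr ⟨h1, ?_, ?_⟩⟩
      · have := hp (j.val + 1)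
        have h0 : j.val ≠ (0 - 1 : Fin n).val := fun h => hj (Fin.ext h)
        rw [if_neg (by omega), if_pos (by simp only [Fin.val_zero]; omega)] at this
        simp only [gap, h2]; omega
      · simp only [gap, h2, hv, psum_of_le w.2 le_rfl, psum_of_le z.2 le_rfl]; omega
      · have := hp 1
        rw [if_neg (by omega), if_pos (by simp)] at this
        simp only [gap, h2, Fin.val_zero, zero_add]; omega
    · have hv := sub_one_val i h0
      refine ⟨0, fun j hj hj' => ?_, Or.inr ⟨h1, ?_, ?_⟩⟩
      · have := hp (j.val + 1)
        have : j.val ≠ (i - 1).val := fun h => hj (Fin.ext h)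
        simp only [gap, h2]
        split_ifs at * <;> omega
      · have := hp ((i - 1).val + 1)
        rw [if_pos (by omega), if_neg (by omega)] at this
        simp only [gap, h2]; omega
      · have := hp (i.val + 1)
        rw [if_pos (by omega), if_pos (by omega)] at this
        simp only [gap, h2]; omega

/-- The operator `f̃_i` shifts the function `cut` uniformly away from the cut at the letter `i`. -/
theorem cut_tensorF (hn : 2 ≤ n) {i : Fin n} {z w : RowCrystal n k × RowCrystal n l}
    (h : tensorF i z = some w) :
    ∃ s : ℤ, ∀ m, m ≠ i.val → (i = 0 → m < n) → cut w m = cut z m + s := by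
  have hi := sub_one_ne hn i
  obtain ⟨s, h1, h2⟩ := gap_tensorF hn h
  refine ⟨s, fun m hm hm' => ?_⟩
  obtain ⟨W, hW⟩ := exists_inf'_eq_min (i - 1) i
    (fun j => gap z.1.mult z.2.mult j + if j.val < m then (k : ℤ) - l else 0)
    (gap z.1.mult z.2.mult (i - 1) + 1 + |(k : ℤ) - l|)
  have habs := le_abs_self ((k : ℤ) - l)
  have habs' := neg_abs_le ((k : ℤ) - l)
  have e1 : cut w m = _ := hW (fun j => gap w.1.mult w.2.mult j + if j.val < m then (k : ℤ) - l else 0)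
    s (fun j hj hj' => by rw [h1 j hj hj']; ring) (by split_ifs <;> omega)
  have e2 : cut z m = _ := hW (fun j => gap z.1.mult z.2.mult j + if j.val < m then (k : ℤ) - l else 0)
    0 (fun j hj hj' => by ring) (by split_ifs <;> omega)
  -- Unless the window starts at `i`, the gaps at `i - 1` and `i` enter as cyclic neighbours, and
  -- `f̃_i` either lowers by one the strictly larger gap at `i` or raises a gap at `i - 1` that is
  -- at least the gap at `i`. Neither affects the minimum, apart from the shift `s`.
  rw [e1, e2]
  clear e1 e2 hW habs habs'
  have hg := gap_sub_one z i
  by_cases h0 : i = 0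
  · have := hm' h0
    have hv : (i - 1).val + 1 = n := by rw [h0]; exact zero_sub_one_val
    rw [if_pos h0] at hg
    have : i.val = 0 := by simp [h0]
    rw [if_neg (by omega), if_pos (by omega)]
    omega
  · have hv := sub_one_val i h0
    rw [if_neg h0] at hg
    by_cases h3 : i.val < m
    · rw [if_pos (by omega), if_pos h3]; omega
    · rw [if_neg (by omega), if_neg h3]; omega

/-- Away from the letters `i - 1` and `i`, consecutive values of `cut` shift together, so these
multiplicities do not change. At the two letters, the local form reduces the claim to
`localForm_step_fst` and `localForm_step_snd`. -/
theorem explicitR_tensorF (hn : 2 ≤ n) {i : Fin n} {z w : RowCrystal n k × RowCrystal n l}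
    (h : tensorF i z = some w) : tensorF i (explicitR z) = some (explicitR w) := by
  have hi := sub_one_ne hn i
  have hother : ∀ j, j ≠ i - 1 → j ≠ i → (explicitR w).1.mult j = (explicitR z).1.mult j ∧
      (explicitR w).2.mult j = (explicitR z).2.mult j := by
    intro j hj hj'
    obtain ⟨s, hs⟩ := cut_tensorF hn h
    have hjv : j.val ≠ i.val := fun h => hj' (Fin.ext h)
    have hjv' : j.val ≠ (i - 1).val := fun h => hj (Fin.ext h)
    have e1 := hs j.val hjv fun _ => j.2
    have e2 := hs (j.val + 1) (fun h' => hjv' (by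
        have h0 : i ≠ 0 := by rintro rfl; simp at h'
        have := sub_one_val i h0
        omega)) (fun h' => by
        have : (i - 1).val + 1 = n := by rw [h']; exact zero_sub_one_val
        have := j.2
        omega)
    have h1 := explicitR_fst w j
    have h2 := explicitR_fst z j
    have h3 := explicitR_snd w j
    have h4 := explicitR_snd z j
    have h5 : w.1.mult j = z.1.mult j ∧ w.2.mult j = z.2.mult j := by
      rcases (tensorF_eq_some_iff hn).1 h with ⟨_, g1, g2⟩ | ⟨_, g1, g2⟩
      · have := g2 j
        rw [if_neg hj, if_neg hj'] at this
        exact ⟨this, by rw [g1]⟩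
      · have := g2 j
        rw [if_neg hj, if_neg hj'] at this
        exact ⟨by rw [g1], this⟩
    omega
  obtain ⟨W, hW⟩ := explicitR_local hn z i
  obtain ⟨s, h1, h2⟩ := gap_tensorF hn h
  have hg := gap_sub_one z i
  have hx := (tensorF_eq_some_iff hn).1 h
  have hxi : (z.2.mult i < z.1.mult (i - 1) ∧ w.2.mult i = z.2.mult i ∧
        w.2.mult (i - 1) = z.2.mult (i - 1) ∧ w.1.mult (i - 1) + 1 = z.1.mult (i - 1) ∧
        w.1.mult i = z.1.mult i + 1) ∨ (z.1.mult (i - 1) ≤ z.2.mult i ∧ w.1.mult i = z.1.mult i ∧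
        w.1.mult (i - 1) = z.1.mult (i - 1) ∧ w.2.mult (i - 1) + 1 = z.2.mult (i - 1) ∧
        w.2.mult i = z.2.mult i + 1) := by
    rcases hx with ⟨g0, g1, g2⟩ | ⟨g0, g1, g2⟩
    · have a1 := g2 i
      have a2 := g2 (i - 1)
      rw [if_neg hi.symm, if_pos rfl] at a1
      rw [if_neg hi, if_pos rfl] at a2
      exact Or.inl ⟨g0, by rw [g1], by rw [g1], a2, a1⟩
    · have a1 := g2 i
      have a2 := g2 (i - 1)
      rw [if_neg hi.symm, if_pos rfl] at a1
      rw [if_neg hi, if_pos rfl] at a2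
      exact Or.inr ⟨g0, by rw [g1], by rw [g1], a2, a1⟩
  have hz := fun h => hW z 0 _ _ _ (fun _ _ _ => (add_zero _).symm) h rfl rfl rfl
  have hw := fun h => hW w s _ _ _ h1 h rfl rfl rfl
  generalize (if i = 0 then (k : ℤ) - l else 0) = ca at *
  have key : ((explicitR z).2.mult i < (explicitR z).1.mult (i - 1) ∧
      (explicitR w).2.mult i = (explicitR z).2.mult i ∧
      (explicitR w).2.mult (i - 1) = (explicitR z).2.mult (i - 1) ∧
      (explicitR w).1.mult (i - 1) + 1 = (explicitR z).1.mult (i - 1) ∧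
      (explicitR w).1.mult i = (explicitR z).1.mult i + 1) ∨
      ((explicitR z).1.mult (i - 1) ≤ (explicitR z).2.mult i ∧
      (explicitR w).1.mult i = (explicitR z).1.mult i ∧
      (explicitR w).1.mult (i - 1) = (explicitR z).1.mult (i - 1) ∧
      (explicitR w).2.mult (i - 1) + 1 = (explicitR z).2.mult (i - 1) ∧
      (explicitR w).2.mult i = (explicitR z).2.mult i + 1) := by
    replace hz := hz (by omega)
    simp only [sub_zero] at hz
    rcases hxi with ⟨h0, e1, e2, e3, e4⟩ | ⟨h0, e1, e2, e3, e4⟩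
    · obtain ⟨h3, h4⟩ : gap w.1.mult w.2.mult (i - 1) - s = gap z.1.mult z.2.mult (i - 1) ∧
          gap w.1.mult w.2.mult i - s + ca = gap z.1.mult z.2.mult i + ca - 1 := by clear hz; omega
      replace hw := hw (by clear hz; omega)
      rw [h3, h4, e1, e2, e4, show (w.1.mult (i - 1) : ℤ) = z.1.mult (i - 1) - 1 by clear hz hw; omega] at hw
      have := localForm_step_fst hz hw hg (by exact_mod_cast h0)
      exact_mod_cast this
    · obtain ⟨h3, h4⟩ : gap w.1.mult w.2.mult (i - 1) - s = gap z.1.mult z.2.mult (i - 1) + 1 ∧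
          gap w.1.mult w.2.mult i - s + ca = gap z.1.mult z.2.mult i + ca := by clear hz; omega
      replace hw := hw (by clear hz; omega)
      rw [h3, h4, e1, e2, e4, show (w.2.mult (i - 1) : ℤ) = z.2.mult (i - 1) - 1 by clear hz hw; omega] at hw
      have := localForm_step_snd hz hw hg (by exact_mod_cast h0)
      exact_mod_cast this
  rw [tensorF_eq_some_iff hn]
  rcases key with ⟨g0, g1, g2, g3, g4⟩ | ⟨g0, g1, g2, g3, g4⟩
  · refine Or.inl ⟨g0, RowCrystal.ext (funext fun j => ?_), fun j => ?_⟩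
    · by_cases hj : j = i - 1
      · rw [hj, g2]
      by_cases hj' : j = i
      · rw [hj', g1]
      exact (hother j hj hj').2
    · by_cases hj : j = i - 1
      · rw [hj, if_pos rfl, if_neg hi, g3]; rfl
      by_cases hj' : j = i
      · rw [hj', if_neg hi.symm, if_pos rfl, g4]
      rw [if_neg hj, if_neg hj', (hother j hj hj').1]
  · refine Or.inr ⟨g0, RowCrystal.ext (funext fun j => ?_), fun j => ?_⟩
    · by_cases hj : j = i - 1
      · rw [hj, g2]
      by_cases hj' : j = i
      · rw [hj', g1]
      exact (hother j hj hj').1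
    · by_cases hj : j = i - 1
      · rw [hj, if_pos rfl, if_neg hi, g3]; rfl
      by_cases hj' : j = i
      · rw [hj', if_neg hi.symm, if_pos rfl, g4]
      rw [if_neg hj, if_neg hj', (hother j hj hj').2]

/-- Maps between tensor products of crystals that commute with all `ẽ_i`, `f̃_i`. -/
def IsMorphism (Φ : RowCrystal n k × RowCrystal n l → RowCrystal n p × RowCrystal n q) : Prop :=
  ∀ i x, tensorE i (Φ x) = (tensorE i x).map Φ ∧ tensorF i (Φ x) = (tensorF i x).map Φ

/-- The nonzero cases follow from `explicitR_tensorF`, since `ẽ_i` and `f̃_i` are partial inverses.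
That zero goes to zero is read off from the local form. -/
theorem isMorphism_explicitR (hn : 2 ≤ n) :
    IsMorphism (explicitR : RowCrystal n k × RowCrystal n l → _) := by
  intro i z
  obtain ⟨W, hW⟩ := explicitR_local hn z i
  have hz := hW z 0 _ _ _ (fun _ _ _ => (add_zero _).symm) (by omega) rfl rfl rfl
  have hg := gap_sub_one z i
  generalize (if i = 0 then (k : ℤ) - l else 0) = ca at *
  constructor
  · rcases h : tensorE i z with _ | w
    · rw [tensorE_eq_none_iff] at h
      rw [Option.map_none, tensorE_eq_none_iff]
      omega
    · rw [tensorE_eq_some_iff hn] at h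
      rw [Option.map_some, tensorE_eq_some_iff hn]
      exact explicitR_tensorF hn h
  · rcases h : tensorF i z with _ | w
    · rw [tensorF_eq_none_iff] at h
      rw [Option.map_none, tensorF_eq_none_iff]
      omega
    · exact explicitR_tensorF hn h

end RowCrystal

/-! ### Uniqueness of morphisms, and identification of the combinatorial R matrix. -/

namespace RowCrystal

variable {n k l p q : ℕ} [NeZero n]

/-- `φ_i` of an element of a tensor product. -/
def tensorPhi (i : Fin n) (z : RowCrystal n k × RowCrystal n l) : ℕ :=
  z.2.mult (i - 1) + (z.1.mult (i - 1) - z.2.mult i)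

theorem tensorPhi_eq_zero_iff {i : Fin n} {z : RowCrystal n k × RowCrystal n l} :
    tensorPhi i z = 0 ↔ tensorF i z = none := by
  rw [tensorF_eq_none_iff, tensorPhi]
  omega

theorem tensorPhi_of_tensorF (hn : 2 ≤ n) {i : Fin n} {z w : RowCrystal n k × RowCrystal n l}
    (h : tensorF i z = some w) : tensorPhi i z = tensorPhi i w + 1 := by
  have hi := sub_one_ne hn i
  unfold tensorPhi
  rcases (tensorF_eq_some_iff hn).1 h with ⟨g0, g1, g2⟩ | ⟨g0, g1, g2⟩
  · have a2 := g2 (i - 1)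
    rw [if_neg hi, if_pos rfl] at a2
    rw [g1]
    omega
  · have a1 := g2 i
    have a2 := g2 (i - 1)
    rw [if_neg hi.symm, if_pos rfl] at a1
    rw [if_neg hi, if_pos rfl] at a2
    rw [g1]
    omega

/-- `tensorPhi i` counts how often `f̃_i` can be applied before the result is zero. -/
theorem IsMorphism.tensorPhi_eq (hn : 2 ≤ n)
    {Φ : RowCrystal n k × RowCrystal n l → RowCrystal n p × RowCrystal n q} (hΦ : IsMorphism Φ)
    (i : Fin n) (z : RowCrystal n k × RowCrystal n l) : tensorPhi i (Φ z) = tensorPhi i z := by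
  induction hm : tensorPhi i z generalizing z with
  | zero =>
    rw [tensorPhi_eq_zero_iff] at hm ⊢
    rw [(hΦ i z).2, hm, Option.map_none]
  | succ m ih =>
    have h : tensorF i z ≠ none := by rw [Ne, ← tensorPhi_eq_zero_iff]; omega
    obtain ⟨w, hw⟩ := Option.ne_none_iff_exists'.1 h
    have h1 := tensorPhi_of_tensorF hn hw
    have h2 := tensorPhi_of_tensorF hn (show tensorF i (Φ z) = some (Φ w) by
      rw [(hΦ i z).2, hw, Option.map_some])
    rw [h2, ih w (by omega)]

/-- The sum of all letters, with letters numbered from zero. -/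
def height (z : RowCrystal n k × RowCrystal n l) : ℕ :=
  ∑ a, a.val * (z.1.mult a + z.2.mult a)

theorem height_lt_of_tensorF (hn : 2 ≤ n) {i : Fin n} (hi0 : i ≠ 0)
    {z w : RowCrystal n k × RowCrystal n l} (h : tensorF i w = some z) : height w < height z := by
  have hs : ∀ a, z.1.mult a + z.2.mult a + (if a = i - 1 then 1 else 0)
      = w.1.mult a + w.2.mult a + if a = i then 1 else 0 := by
    intro a
    rcases (tensorF_eq_some_iff hn).1 h with ⟨g0, g1, g2⟩ | ⟨g0, g1, g2⟩ <;>
    · have := g2 a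
      rw [g1]
      omega
  have hc : ∀ c : Fin n, ∑ a : Fin n, a.val * (if a = c then 1 else 0) = c.val := by
    intro c
    simp
  have h1 : height z + (i - 1).val = height w + i.val := by
    rw [height, height, ← hc (i - 1), ← hc i, ← Finset.sum_add_distrib, ← Finset.sum_add_distrib]
    refine Finset.sum_congr rfl fun a _ => ?_
    rw [← mul_add, hs, mul_add]
  have := sub_one_val i hi0
  omega

/-- In a highest weight element the first factor has only letters 0, and the second only letters 0
and 1. The number of letters 1 is the one free parameter, and `φ_1` is strictly decreasing in it. -/
theorem highestWeight_ext (hn : 2 ≤ n) {z w : RowCrystal n k × RowCrystal n l}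
    (hz : ∀ i ≠ 0, tensorE i z = none) (hw : ∀ i ≠ 0, tensorE i w = none)
    (h : tensorPhi 1 z = tensorPhi 1 w) : z = w := by
  have h10 : (1 : Fin n) ≠ 0 := by simpa using (sub_one_ne hn 1).symm
  have key : ∀ z : RowCrystal n k × RowCrystal n l, (∀ i ≠ 0, tensorE i z = none) →
      z.1.mult 0 = k ∧ z.2.mult 0 + z.2.mult 1 = l ∧ z.2.mult 1 ≤ k ∧
      (∀ a ≠ 0, z.1.mult a = 0) ∧ ∀ a, a ≠ 0 → a ≠ 1 → z.2.mult a = 0 := by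
    intro z hz
    have h1 : ∀ a ≠ 0, z.1.mult a = 0 := fun a ha => (tensorE_eq_none_iff.1 (hz a ha)).2
    have h2 : ∀ a, a ≠ 0 → a ≠ 1 → z.2.mult a = 0 := fun a ha ha1 => by
      have h3 := (tensorE_eq_none_iff.1 (hz a ha)).1
      rw [h1 (a - 1) (sub_ne_zero.2 ha1)] at h3
      omega
    have h3 : z.1.mult 0 = k :=
      (Finset.sum_eq_single 0 (fun a _ ha => h1 a ha) (by simp)).symm.trans z.1.sum_mult
    have h4 : z.2.mult 0 + z.2.mult 1 = l :=
      (Finset.sum_eq_add 0 1 h10.symm (fun a _ ha => h2 a ha.1 ha.2)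
        (by simp) (by simp)).symm.trans z.2.sum_mult
    have h5 := (tensorE_eq_none_iff.1 (hz 1 h10)).1
    rw [sub_self] at h5
    exact ⟨h3, h4, by omega, h1, h2⟩
  obtain ⟨a1, a2, a3, a4, a5⟩ := key z hz
  obtain ⟨b1, b2, b3, b4, b5⟩ := key w hw
  simp only [tensorPhi, sub_self] at h
  refine Prod.ext (RowCrystal.ext (funext fun a => ?_)) (RowCrystal.ext (funext fun a => ?_))
  · by_cases ha : a = 0
    · rw [ha, a1, b1]
    · rw [a4 a ha, b4 a ha]
  · by_cases ha : a = 0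
    · rw [ha]; omega
    by_cases ha1 : a = 1
    · rw [ha1]; omega
    rw [a5 a ha ha1, b5 a ha ha1]

/-- There is at most one morphism between two tensor products of one row crystals. -/
theorem IsMorphism.eq (hn : 2 ≤ n)
    {Φ Ψ : RowCrystal n k × RowCrystal n l → RowCrystal n p × RowCrystal n q}
    (hΦ : IsMorphism Φ) (hΨ : IsMorphism Ψ) (z : RowCrystal n k × RowCrystal n l) :
    Φ z = Ψ z := by
  induction hm : height z using Nat.strong_induction_on generalizing z with
  | _ m ih =>
    -- The operators `ẽ_i` with `i ≠ 0` lower the height, so the induction descends to highest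
    -- weight elements.
    by_cases h : ∃ i ≠ 0, tensorE i z ≠ none
    · obtain ⟨i, hi, h⟩ := h
      obtain ⟨w, hw⟩ := Option.ne_none_iff_exists'.1 h
      have hw' := (tensorE_eq_some_iff hn).1 hw
      have h1 : tensorF i (Φ w) = some (Φ z) := by rw [(hΦ i w).2, hw', Option.map_some]
      have h2 : tensorF i (Ψ w) = some (Ψ z) := by rw [(hΨ i w).2, hw', Option.map_some]
      rw [ih _ (hm ▸ height_lt_of_tensorF hn hi hw') w rfl, h2] at h1
      exact (Option.some.inj h1).symm
    · push Not at h
      refine highestWeight_ext hn (fun i hi => ?_) (fun i hi => ?_) ?_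
      · rw [(hΦ i z).1, h i hi, Option.map_none]
      · rw [(hΨ i z).1, h i hi, Option.map_none]
      · rw [hΦ.tensorPhi_eq hn, hΨ.tensorPhi_eq hn]

/-- The double application and the identity are both morphisms, so uniqueness gives bijectivity
without computation. -/
theorem explicitR_explicitR (hn : 2 ≤ n) (z : RowCrystal n k × RowCrystal n l) :
    explicitR (explicitR z) = z := by
  refine IsMorphism.eq (Φ := fun z => explicitR (explicitR z)) (Ψ := id) hn (fun i x => ?_)
    (fun i x => by simp) z
  rw [(isMorphism_explicitR hn i _).1, (isMorphism_explicitR hn i _).2,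
    (isMorphism_explicitR hn i _).1, (isMorphism_explicitR hn i _).2, Option.map_map,
    Option.map_map]
  exact ⟨rfl, rfl⟩

instance subsingleton_one : Subsingleton (RowCrystal 1 k) :=
  ⟨fun a b => RowCrystal.ext (funext fun i => by
    have h1 := a.sum_mult
    have h2 := b.sum_mult
    rw [Fin.sum_univ_one] at h1 h2
    rw [Subsingleton.elim i 0, h1, h2])⟩

theorem exists_isCrystalIso (hn : 2 ≤ n) (k l : ℕ) :
    ∃ Φ : RowCrystal n k × RowCrystal n l ≃ RowCrystal n l × RowCrystal n k, IsCrystalIso Φ :=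
  ⟨⟨explicitR, explicitR, explicitR_explicitR hn, explicitR_explicitR hn⟩,
    isMorphism_explicitR hn⟩

/-- For a single letter every operator replaces the letter by itself. Positive lengths ensure that
it never gives zero. -/
theorem isCrystalIso_of_one (hk : 0 < k) (hl : 0 < l)
    (Φ : RowCrystal 1 k × RowCrystal 1 l ≃ RowCrystal 1 l × RowCrystal 1 k) :
    IsCrystalIso Φ := by
  have hm : ∀ {m : ℕ} (b : RowCrystal 1 m) (i : Fin 1), b.mult i = m := fun b i => by
    have := b.sum_mult
    rw [Fin.sum_univ_one] at this
    rw [Subsingleton.elim i 0, this]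
  have hsome : ∀ {p q : ℕ}, 0 < p → 0 < q → ∀ (i : Fin 1) (z w : RowCrystal 1 p × RowCrystal 1 q),
      tensorE i z = some w ∧ tensorF i z = some w := by
    intro p q hp hq i z w
    constructor
    · have h : tensorE i z ≠ none := by
        rw [Ne, tensorE_eq_none_iff, hm, hm, hm]; omega
      obtain ⟨w', hw'⟩ := Option.ne_none_iff_exists'.1 h
      rw [hw', Subsingleton.elim w w']
    · have h : tensorF i z ≠ none := by
        rw [Ne, tensorF_eq_none_iff, hm, hm, hm]; omega
      obtain ⟨w', hw'⟩ := Option.ne_none_iff_exists'.1 h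
      rw [hw', Subsingleton.elim w w']
  intro i x
  rw [(hsome hk hl i x x).1, (hsome hk hl i x x).2, (hsome hl hk i _ (Φ x)).1,
    (hsome hl hk i _ (Φ x)).2]
  exact ⟨rfl, rfl⟩

/-- For `n = 1` and for `n ≥ 2` the combinatorial `R` matrix is given by the explicit formula. -/
theorem combinatorialR_apply (z : RowCrystal n k × RowCrystal n l) :
    combinatorialR n k l z = explicitR z := by
  rcases Nat.lt_or_ge n 2 with hn | hn
  · obtain rfl : n = 1 := by have := NeZero.pos n; omega
    exact Subsingleton.elim _ _
  · exact IsMorphism.eq hn (Classical.epsilon_spec (exists_isCrystalIso hn k l))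
      (isMorphism_explicitR hn) z

/-- The combinatorial `R` matrix is the only isomorphism of crystals. -/
theorem isCrystalIso_iff (hk : 0 < k) (hl : 0 < l)
    (Φ : RowCrystal n k × RowCrystal n l ≃ RowCrystal n l × RowCrystal n k) :
    IsCrystalIso Φ ↔ Φ = combinatorialR n k l := by
  rcases Nat.lt_or_ge n 2 with hn | hn
  · obtain rfl : n = 1 := by have := NeZero.pos n; omega
    exact ⟨fun _ => Subsingleton.elim _ _, fun _ => isCrystalIso_of_one hk hl Φ⟩
  · have h := Classical.epsilon_spec (exists_isCrystalIso hn k l)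
    refine ⟨fun hΦ => Equiv.ext fun z => IsMorphism.eq hn hΦ h z, ?_⟩
    rintro rfl
    exact h

end RowCrystal

/-! ### Counts of large letters: the R matrix as a carrier rule and as a recursion. -/

namespace RowCrystal

variable {n k l : ℕ}

/-- The number of letters that are at least `a`, as an integer. -/
def up (b : RowCrystal n k) (a : ℕ) : ℤ := k - psum b.mult a

theorem up_zero (b : RowCrystal n k) : b.up 0 = k := by simp [up, psum_zero]

theorem up_of_le (b : RowCrystal n k) {a : ℕ} (h : n ≤ a) : b.up a = 0 := by
  simp [up, psum_of_le b h]

theorem up_eq_succ (b : RowCrystal n k) (j : Fin n) :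
    b.up j.val = b.up (j.val + 1) + b.mult j := by
  have := psum_succ b.mult j
  simp only [up] at *
  omega

theorem up_anti (b : RowCrystal n k) {a a' : ℕ} (h : a ≤ a') : b.up a' ≤ b.up a := by
  have := psum_mono b.mult h
  simp only [up] at *
  omega

theorem up_nonneg (b : RowCrystal n k) (a : ℕ) : 0 ≤ b.up a := by
  rw [← b.up_of_le (le_max_left n a)]
  exact b.up_anti (le_max_right _ _)

theorem up_le (b : RowCrystal n k) (a : ℕ) : b.up a ≤ k := by
  rw [← b.up_zero]
  exact b.up_anti (Nat.zero_le _)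

theorem ext_up {b c : RowCrystal n k} (h : ∀ a, 1 ≤ a → a < n → b.up a = c.up a) : b = c := by
  have h' : ∀ a, b.up a = c.up a := by
    intro a
    rcases Nat.eq_zero_or_pos a with rfl | h0
    · rw [up_zero, up_zero]
    rcases Nat.lt_or_ge a n with h1 | h1
    · exact h a h0 h1
    · rw [up_of_le b h1, up_of_le c h1]
  refine RowCrystal.ext (funext fun j => ?_)
  have h1 := b.up_eq_succ j
  have h2 := c.up_eq_succ j
  rw [h', h'] at h1
  omega

variable [NeZero n]

theorem psum_one (b : RowCrystal n k) : psum b.mult 1 = b.mult 0 := by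
  have := psum_succ b.mult 0
  rw [Fin.val_zero, psum_zero, zero_add, zero_add] at this
  exact this

theorem gap_zero_le {z : RowCrystal n k × RowCrystal n l} (h : z.2.up 1 ≤ z.1.mult 0) (j : Fin n) :
    gap z.1.mult z.2.mult 0 ≤ gap z.1.mult z.2.mult j := by
  rcases Nat.eq_zero_or_pos j.val with h0 | h0
  · rw [show j = 0 from Fin.ext (by simpa using h0)]
  · have h1 := psum_mono z.1.mult (show 1 ≤ j.val from h0)
    have h2 := z.2.up_nonneg (j.val + 1)
    have h3 := psum_one z.1
    simp only [up, gap, Fin.val_zero, psum_zero, zero_add] at *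
    omega

/-- The window at `j + 1` has one entry that the window at `j` lacks, namely `gap j + (k - l)`. It
is harmless if `l ≤ k`, as `gap j` is no larger, and also if the gap at 0 is minimal, as the entry
of the letter 0 is no larger. -/
theorem cut_eq_min (z : RowCrystal n k × RowCrystal n l) (j : Fin n)
    (h : l ≤ k ∨ j ≠ 0 ∧ z.2.up 1 ≤ z.1.mult 0) :
    cut z j.val = min (gap z.1.mult z.2.mult j) (cut z (j.val + 1)) := by
  have h0 := cutMin_le (gap z.1.mult z.2.mult) ((k : ℤ) - l) j.val j
  rw [if_neg (lt_irrefl _), add_zero] at h0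
  refine le_antisymm (le_min h0 ?_) ?_
  · obtain ⟨i, hi⟩ := exists_cutMin_eq (gap z.1.mult z.2.mult) ((k : ℤ) - l) (j.val + 1)
    have h1 := cutMin_le (gap z.1.mult z.2.mult) ((k : ℤ) - l) j.val i
    by_cases hij : i = j
    · subst hij
      rw [if_pos (Nat.lt_succ_self _)] at hi
      rcases h with h | ⟨h2, h3⟩
      · simp only [cut] at *; omega
      · have h4 := cutMin_le (gap z.1.mult z.2.mult) ((k : ℤ) - l) i.val 0
        have h5 := gap_zero_le h3 i
        have h6 : i.val ≠ 0 := fun h => h2 (Fin.ext (by simpa using h))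
        rw [if_pos (by simp only [Fin.val_zero]; omega)] at h4
        simp only [cut] at *; omega
    · have : i.val ≠ j.val := fun h => hij (Fin.ext h)
      simp only [cut] at *
      split_ifs at * <;> omega
  · obtain ⟨i, hi⟩ := exists_cutMin_eq (gap z.1.mult z.2.mult) ((k : ℤ) - l) j.val
    have h1 := cutMin_le (gap z.1.mult z.2.mult) ((k : ℤ) - l) (j.val + 1) i
    by_cases hij : i = j
    · subst hij
      rw [if_neg (lt_irrefl _), add_zero] at hi
      exact (min_le_left _ _).trans hi.ge
    · have : i.val ≠ j.val := fun h => hij (Fin.ext h)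
      refine (min_le_right _ _).trans ?_
      simp only [cut] at *
      split_ifs at * <;> omega

theorem psum_explicitR_fst (z : RowCrystal n k × RowCrystal n l) {i : ℕ} (h : i ≤ n) :
    psum (explicitR z).1.mult i = psum z.1.mult i - cut z i + cut z 0 := by
  induction i with
  | zero => simp [psum_zero]
  | succ i ih =>
    have h1 := psum_succ (explicitR z).1.mult ⟨i, h⟩
    have h2 := psum_succ z.1.mult ⟨i, h⟩
    have h3 := explicitR_fst z ⟨i, h⟩
    have h4 := ih (by omega)
    dsimp only at *
    omega

theorem up_explicitR_fst (z : RowCrystal n k × RowCrystal n l) {a : ℕ} (h : a ≤ n) :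
    (explicitR z).1.up a = z.1.up a - cut z n + cut z a := by
  have h1 := psum_explicitR_fst z h
  have h2 := cut_top z
  simp only [up] at *
  omega

theorem up_explicitR_add (z : RowCrystal n k × RowCrystal n l) (a : ℕ) :
    (explicitR z).1.up a + (explicitR z).2.up a = z.1.up a + z.2.up a := by
  rcases Nat.lt_or_ge n a with h | h
  · simp only [up_of_le _ h.le]
  induction h using Nat.decreasingInduction with
  | self => simp only [up_of_le _ le_rfl]
  | of_succ j hj ih =>
    have h1 := explicitR_fst z ⟨j, hj⟩
    have h2 := explicitR_snd z ⟨j, hj⟩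
    have h3 := z.1.up_eq_succ ⟨j, hj⟩
    have h4 := z.2.up_eq_succ ⟨j, hj⟩
    have h5 := (explicitR z).1.up_eq_succ ⟨j, hj⟩
    have h6 := (explicitR z).2.up_eq_succ ⟨j, hj⟩
    dsimp only at *
    omega

/-- If the first factor contains sufficiently many letters `0`, then the combinatorial `R` matrix is
the rule by which a carrier exchanges letters with a box. -/
theorem explicitR_carrier {z : RowCrystal n k × RowCrystal n l} (h : z.2.up 1 ≤ z.1.mult 0)
    {H : ℕ → ℤ} (hn : H n = 0) (hH : ∀ a, 1 ≤ a → a < n →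
      H a = max (H (a + 1)) (z.1.up a - z.2.up (a + 1) - z.2.mult 0))
    {a : ℕ} (h1 : 1 ≤ a) (ha : a ≤ n) :
    (explicitR z).1.up a = z.1.up a - H a ∧ (explicitR z).2.up a = z.2.up a + H a := by
  have h0 : cut z 0 = gap z.1.mult z.2.mult 0 := by
    obtain ⟨i, hi⟩ := exists_cutMin_eq (gap z.1.mult z.2.mult) ((k : ℤ) - l) 0
    have h2 := cutMin_le (gap z.1.mult z.2.mult) ((k : ℤ) - l) 0 0
    have h3 := gap_zero_le h i
    simp only [cut, Nat.not_lt_zero, if_false] at *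
    omega
  -- Both sides vanish at `n`, and `cut_eq_min` gives them the same downward recursion.
  have key : H a = cut z n - cut z a := by
    induction ha using Nat.decreasingInduction with
    | self => rw [hn, sub_self]
    | of_succ j hj ih =>
      have h2 := cut_eq_min z ⟨j, hj⟩
        (Or.inr ⟨fun h => by simp only [Fin.ext_iff, Fin.val_zero] at h; omega, h⟩)
      have h3 := hH j h1 hj
      have h4 := cut_top z
      have h5 := psum_one z.2
      rw [ih (by omega)] at h3
      simp only [gap, up, Fin.val_zero, psum_zero, zero_add] at *
      omega
  have h2 := up_explicitR_fst z ha
  have h3 := up_explicitR_add z a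
  omega

/-- The number `k - cut z 0`, which hence lies between `k` and `2 * k`, becomes the phase shift of
the solitons. -/
theorem cut_zero_mem (z : RowCrystal n l × RowCrystal n k) :
    -(k : ℤ) ≤ cut z 0 ∧ cut z 0 ≤ 0 := by
  obtain ⟨i, hi⟩ := exists_cutMin_eq (gap z.1.mult z.2.mult) ((l : ℤ) - k) 0
  have h1 := cutMin_le (gap z.1.mult z.2.mult) ((l : ℤ) - k) 0 0
  have h2 := psum_nonneg z.1.mult i.val
  have h3 := z.2.up_nonneg (i.val + 1)
  have h4 := psum_nonneg z.2.mult 1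
  simp only [cut, gap, up, Nat.not_lt_zero, if_false, Fin.val_zero, psum_zero, zero_add] at *
  omega

/-- The recursion for the first component of the combinatorial `R` matrix in the case of a longer
first factor. -/
theorem explicitR_fst_eq_min (z : RowCrystal n l × RowCrystal n k) (h : k ≤ l) (j : Fin n) :
    ((explicitR z).1.mult j : ℤ) = min (z.1.mult j : ℤ)
      (z.2.up (j.val + 1) - (explicitR z).1.up (j.val + 1) - cut z 0) := by
  have h1 := explicitR_fst z j
  have h2 := cut_eq_min z j (Or.inl h)
  have h3 := up_explicitR_fst z (show j.val + 1 ≤ n from j.2)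
  have h4 := cut_top z
  have h5 := psum_succ z.1.mult j
  rw [h1, h3]
  simp only [gap, up] at *
  omega

end RowCrystal

/-! ### The ultradiscrete tau function and its bilinear equation. -/

/-- The tau function of two solitons with phases `ξ` and `ζ`. -/
def tau (β γ δ ξ ζ : ℤ) : ℤ := max (max 0 (ξ - β)) (max (ζ - γ) (ξ + ζ - δ))

theorem le_tau (β γ δ ξ ζ : ℤ) : 0 ≤ tau β γ δ ξ ζ ∧ ξ - β ≤ tau β γ δ ξ ζ ∧
    ζ - γ ≤ tau β γ δ ξ ζ ∧ ξ + ζ - δ ≤ tau β γ δ ξ ζ := by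
  unfold tau
  refine ⟨?_, ?_, ?_, ?_⟩ <;> omega

theorem tau_cases (β γ δ ξ ζ : ℤ) : tau β γ δ ξ ζ = 0 ∨ tau β γ δ ξ ζ = ξ - β ∨
    tau β γ δ ξ ζ = ζ - γ ∨ tau β γ δ ξ ζ = ξ + ζ - δ := by
  unfold tau
  omega

section

variable {l k θ b c c' m r β γ δ ξ ζ : ℤ} (hk : 0 ≤ k) (hkl : k ≤ l) (hθ : 0 ≤ θ)
    (hb : 0 ≤ b) (hbl : b ≤ l) (hc : 0 ≤ c) (hc' : 0 ≤ c')
    (h : c' = min b (δ - β - γ - k)) (hm : m = min θ l) (hr : r = min θ k)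
include hk hkl hθ hb hbl hc hc' h hm hr

/-- Each tau function on the left equals one of its four terms, `m` and `r` have three regimes
according to the position of `θ` relative to `k` and `l`, and `c'` has two. In every combination the
bounds of `le_tau` reduce the claim to linear arithmetic. The two reverse inequalities are proved in
the same way. -/
theorem tau_add_tau_le :
    tau (β + b) (γ + c') (δ + b + c) (ξ + m - l) (ζ + r - k) + tau β γ δ ξ ζ
      ≤ max (tau β γ δ (ξ + m - l) (ζ + r - k) + tau (β + b) (γ + c') (δ + b + c) ξ ζ)
        (tau (β + b) (γ + c') (δ + b + c) (ξ - l) (ζ - k) + tau β γ δ (ξ + m) (ζ + r) - θ) := by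
  obtain ⟨p1, p2, p3, p4⟩ := le_tau β γ δ (ξ + m - l) (ζ + r - k)
  obtain ⟨q1, q2, q3, q4⟩ := le_tau (β + b) (γ + c') (δ + b + c) ξ ζ
  obtain ⟨s1, s2, s3, s4⟩ := le_tau (β + b) (γ + c') (δ + b + c) (ξ - l) (ζ - k)
  obtain ⟨t1, t2, t3, t4⟩ := le_tau β γ δ (ξ + m) (ζ + r)
  generalize tau β γ δ (ξ + m - l) (ζ + r - k) = P at *
  generalize tau (β + b) (γ + c') (δ + b + c) ξ ζ = Q at *
  generalize tau (β + b) (γ + c') (δ + b + c) (ξ - l) (ζ - k) = S at *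
  generalize tau β γ δ (ξ + m) (ζ + r) = T at *
  have h1 : (θ ≤ k ∧ m = θ ∧ r = θ) ∨ (k ≤ θ ∧ θ ≤ l ∧ m = θ ∧ r = k) ∨
    (l ≤ θ ∧ m = l ∧ r = k) := by omega
  have h2 : (c' = b ∧ b ≤ δ - β - γ - k) ∨ (c' = δ - β - γ - k ∧ δ - β - γ - k ≤ b) := by omega
  clear h hm hr
  rw [le_max_iff]
  by_contra! hcon
  obtain ⟨g1, g2⟩ := hcon
  rcases tau_cases (β + b) (γ + c') (δ + b + c) (ξ + m - l) (ζ + r - k) with e | e | e | e <;>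
  rcases tau_cases β γ δ ξ ζ with e' | e' | e' | e' <;> rw [e, e'] at g1 g2 <;> clear e e' <;>
  rcases h1 with ⟨h1, rfl, rfl⟩ | ⟨h1, h1', rfl, rfl⟩ | ⟨h1, rfl, rfl⟩ <;>
  rcases h2 with ⟨rfl, h2⟩ | ⟨rfl, h2⟩ <;> linarith

theorem le_tau_add_tau_left :
    tau β γ δ (ξ + m - l) (ζ + r - k) + tau (β + b) (γ + c') (δ + b + c) ξ ζ
      ≤ tau (β + b) (γ + c') (δ + b + c) (ξ + m - l) (ζ + r - k) + tau β γ δ ξ ζ := by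
  obtain ⟨p1, p2, p3, p4⟩ := le_tau (β + b) (γ + c') (δ + b + c) (ξ + m - l) (ζ + r - k)
  obtain ⟨q1, q2, q3, q4⟩ := le_tau β γ δ ξ ζ
  generalize tau (β + b) (γ + c') (δ + b + c) (ξ + m - l) (ζ + r - k) = P at *
  generalize tau β γ δ ξ ζ = Q at *
  have h1 : (θ ≤ k ∧ m = θ ∧ r = θ) ∨ (k ≤ θ ∧ θ ≤ l ∧ m = θ ∧ r = k) ∨
    (l ≤ θ ∧ m = l ∧ r = k) := by omega
  have h2 : (c' = b ∧ b ≤ δ - β - γ - k) ∨ (c' = δ - β - γ - k ∧ δ - β - γ - k ≤ b) := by omega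
  clear h hm hr
  by_contra! g
  rcases tau_cases β γ δ (ξ + m - l) (ζ + r - k) with e | e | e | e <;>
  rcases tau_cases (β + b) (γ + c') (δ + b + c) ξ ζ with e' | e' | e' | e' <;>
  rw [e, e'] at g <;> clear e e' <;>
  rcases h1 with ⟨h1, rfl, rfl⟩ | ⟨h1, h1', rfl, rfl⟩ | ⟨h1, rfl, rfl⟩ <;>
  rcases h2 with ⟨rfl, h2⟩ | ⟨rfl, h2⟩ <;> linarith

theorem le_tau_add_tau_right :
    tau (β + b) (γ + c') (δ + b + c) (ξ - l) (ζ - k) + tau β γ δ (ξ + m) (ζ + r) - θ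
      ≤ tau (β + b) (γ + c') (δ + b + c) (ξ + m - l) (ζ + r - k) + tau β γ δ ξ ζ := by
  obtain ⟨p1, p2, p3, p4⟩ := le_tau (β + b) (γ + c') (δ + b + c) (ξ + m - l) (ζ + r - k)
  obtain ⟨q1, q2, q3, q4⟩ := le_tau β γ δ ξ ζ
  generalize tau (β + b) (γ + c') (δ + b + c) (ξ + m - l) (ζ + r - k) = P at *
  generalize tau β γ δ ξ ζ = Q at *
  have h1 : (θ ≤ k ∧ m = θ ∧ r = θ) ∨ (k ≤ θ ∧ θ ≤ l ∧ m = θ ∧ r = k) ∨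
    (l ≤ θ ∧ m = l ∧ r = k) := by omega
  have h2 : (c' = b ∧ b ≤ δ - β - γ - k) ∨ (c' = δ - β - γ - k ∧ δ - β - γ - k ≤ b) := by omega
  clear h hm hr
  by_contra! g
  rcases tau_cases (β + b) (γ + c') (δ + b + c) (ξ - l) (ζ - k) with e | e | e | e <;>
  rcases tau_cases β γ δ (ξ + m) (ζ + r) with e' | e' | e' | e' <;>
  rw [e, e'] at g <;> clear e e' <;>
  rcases h1 with ⟨h1, rfl, rfl⟩ | ⟨h1, h1', rfl, rfl⟩ | ⟨h1, rfl, rfl⟩ <;>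
  rcases h2 with ⟨rfl, h2⟩ | ⟨rfl, h2⟩ <;> linarith

/-- The ultradiscrete bilinear equation for the tau function of two solitons. -/
theorem tau_bilinear :
    tau (β + b) (γ + c') (δ + b + c) (ξ + m - l) (ζ + r - k) + tau β γ δ ξ ζ
      = max (tau β γ δ (ξ + m - l) (ζ + r - k) + tau (β + b) (γ + c') (δ + b + c) ξ ζ)
        (tau (β + b) (γ + c') (δ + b + c) (ξ - l) (ζ - k) + tau β γ δ (ξ + m) (ζ + r) - θ) :=
  le_antisymm (tau_add_tau_le hk hkl hθ hb hbl hc hc' h hm hr)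
    (max_le (le_tau_add_tau_left hk hkl hθ hb hbl hc hc' h hm hr)
      (le_tau_add_tau_right hk hkl hθ hb hbl hc hc' h hm hr))

end

/-! ### Profiles of states and the time evolution as a max-plus recursion. -/

namespace Automaton

open RowCrystal

variable {M : ℕ} {θ : ℤ → ℕ} {κ k l : ℕ}

/-- `F n a` is the number of letters greater than `a` in the boxes up to number `n`, for all `a`
between `0` and `M`. -/
def HasProfile (p : State M θ) (F : ℤ → ℕ → ℤ) : Prop :=
  (∀ n a, a ≤ M → (p n).up (a + 1) = F n a - F (n - 1) a) ∧
    ∀ᶠ n in atBot, ∀ a, a ≤ M → F n a = 0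

theorem HasProfile.state_eq {p q : State M θ} {F : ℤ → ℕ → ℤ} (hp : HasProfile p F)
    (hq : HasProfile q F) : p = q := by
  funext n
  refine ext_up fun a h1 h2 => ?_
  obtain ⟨a, rfl⟩ := Nat.exists_eq_add_of_le' h1
  rw [hp.1 n a (by omega), hq.1 n a (by omega)]

theorem HasProfile.eq {p : State M θ} {F F' : ℤ → ℕ → ℤ} (hF : HasProfile p F)
    (hF' : HasProfile p F') {a : ℕ} (ha : a ≤ M) (n : ℤ) : F n a = F' n a := by
  obtain ⟨N, hN⟩ := eventually_atBot.1 (hF.2.and hF'.2)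
  rcases le_total n N with h | h
  · rw [(hN n h).1 a ha, (hN n h).2 a ha]
  · induction n, h using Int.leInduction with
    | base => rw [(hN N le_rfl).1 a ha, (hN N le_rfl).2 a ha]
    | succ n _ ih =>
      have h1 := hF.1 (n + 1) a ha
      have h2 := hF'.1 (n + 1) a ha
      rw [add_sub_cancel_right] at h1 h2
      omega

/-- Letters greater than `a` are among those greater than 0, so `F · a` is constant wherever `F · 0`
is. This is used to recover labels. -/
theorem HasProfile.mono {p : State M θ} {F : ℤ → ℕ → ℤ} (hF : HasProfile p F) {a : ℕ}
    (ha : a ≤ M) {m n : ℤ} (h : m ≤ n) :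
    F m a ≤ F n a ∧ F n a - F m a ≤ F n 0 - F m 0 := by
  induction n, h using Int.leInduction with
  | base => simp
  | succ n _ ih =>
    have h1 := hF.1 (n + 1) a ha
    have h2 := hF.1 (n + 1) 0 (Nat.zero_le _)
    have h3 := (p (n + 1)).up_nonneg (a + 1)
    have h4 := (p (n + 1)).up_anti (show 0 + 1 ≤ a + 1 by omega)
    rw [add_sub_cancel_right] at h1 h2
    omega

theorem up_u (n : ℕ) [NeZero n] (m : ℕ) {a : ℕ} (h : 1 ≤ a) : (u n m).up a = 0 := by
  have h1 := (u n m).up_nonneg a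
  have h2 := (u n m).up_anti h
  have h3 := psum_one (u n m)
  have h4 : (u n m).mult 0 = m := by simp [u]
  simp only [up] at *
  omega

theorem eq_u {n : ℕ} [NeZero n] {m : ℕ} {b : RowCrystal n m}
    (h : ∀ a, 1 ≤ a → a < n → b.up a = 0) : b = u n m :=
  ext_up fun a h1 h2 => by rw [h a h1 h2, up_u n m h1]

/-- The carrier is known far to the left, and the R matrices then determine it step by step. -/
theorem IsTimeEvolution.unique {p q q' : State M θ} (h : IsTimeEvolution κ p q)
    (h' : IsTimeEvolution κ p q') : q = q' := by
  obtain ⟨v, hv, -, hvR⟩ := h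
  obtain ⟨v', hv', -, hvR'⟩ := h'
  obtain ⟨N, hN⟩ := eventually_atBot.1 (hv.and hv')
  have key : ∀ n, v n = v' n := by
    intro n
    rcases le_total n N with h | h
    · rw [(hN n h).1, (hN n h).2]
    · induction n, h using Int.leInduction with
      | base => rw [(hN N le_rfl).1, (hN N le_rfl).2]
      | succ n _ ih =>
        have h1 := hvR n
        rw [ih, hvR' n] at h1
        exact (congrArg Prod.snd h1).symm
  funext n
  have h1 := hvR n
  rw [key, hvR' n] at h1
  exact (congrArg Prod.fst h1).symm

/-- The time evolution in terms of profiles. -/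
theorem HasProfile.timeEvolution {p : State M θ} {F F' : ℤ → ℕ → ℤ} (hF : HasProfile p F)
    (hF' : ∀ᶠ n in atBot, ∀ a, a ≤ M → F' n a = 0)
    (htop : ∀ᶠ n in atTop, ∀ a, a ≤ M → F n a = F' n a)
    (hM : ∀ n, F n M = 0 ∧ F' n M = 0) (hκ : ∀ n, F n 0 - F' (n - 1) 0 ≤ κ)
    (hrec : ∀ n a, a < M → F (n - 1) a - F' n a = max (F (n - 1) (a + 1) - F' n (a + 1))
      (F (n - 1) a - F' (n - 1) a - (F n (a + 1) - F (n - 1) (a + 1))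
        - (θ n - (F n 0 - F (n - 1) 0)))) :
    HasProfile (T κ p) F' := by
  -- By conservation of letters, the carrier entering box `n` holds what the boxes before `n` have
  -- lost in total. The bound `hκ` is the condition of `explicitR_carrier`: the carrier has enough
  -- letters 0 for the contents of the box.
  have step : ∀ (n : ℤ) (v : RowCrystal (M + 1) κ),
      (∀ a, a ≤ M → v.up (a + 1) = F (n - 1) a - F' (n - 1) a) → ∀ a, a ≤ M →
      (explicitR (v, p n)).1.up (a + 1) = F' n a - F' (n - 1) a ∧
      (explicitR (v, p n)).2.up (a + 1) = F n a - F' n a := by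
    intro n v hv a ha
    have hp := hF.1 n
    have hv1 := psum_one v
    have hp1 := psum_one (p n)
    have hv0 := hv 0 (Nat.zero_le _)
    have hp0 := hp 0 (Nat.zero_le _)
    have hc := hκ n
    have := explicitR_carrier (z := (v, p n)) (H := fun j => F (n - 1) (j - 1) - F' n (j - 1))
      (by simp only [up, zero_add] at *; omega)
      (by simp only [Nat.add_sub_cancel, (hM _).1, (hM _).2, sub_self])
      (fun j h1 h2 => by
        obtain ⟨j, rfl⟩ := Nat.exists_eq_add_of_le' h1
        have h3 := hrec n j (by omega)
        rw [hv j (by omega), hp (j + 1) (by omega)]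
        simp only [Nat.add_sub_cancel]
        rw [h3]
        simp only [up, zero_add] at *
        congr 1
        omega) (show 1 ≤ a + 1 by omega) (by omega)
    rw [hv a ha, hp a ha] at this
    simp only [Nat.add_sub_cancel] at this
    omega
  obtain ⟨N, hN⟩ := eventually_atBot.1 (hF.2.and hF')
  let w : ℕ → RowCrystal (M + 1) κ :=
    fun j => Nat.rec (u (M + 1) κ) (fun j v => (explicitR (v, p (N + j))).2) j
  let v : ℤ → RowCrystal (M + 1) κ := fun n => w (n - N).toNat
  have hv0 : ∀ n ≤ N, v n = u (M + 1) κ := fun n hn => by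
    simp only [v, Int.toNat_of_nonpos (sub_nonpos.2 hn)]
    rfl
  have hvs : ∀ n, N ≤ n → v (n + 1) = (explicitR (v n, p n)).2 := fun n hn => by
    obtain ⟨j, rfl⟩ := Int.le.dest hn
    have h1 : (N + (j : ℤ) + 1 - N).toNat = j + 1 := by omega
    have h2 : (N + (j : ℤ) - N).toNat = j := by omega
    simp only [v, h1, h2]
    rfl
  have hv : ∀ n a, a ≤ M → (v n).up (a + 1) = F (n - 1) a - F' (n - 1) a := by
    intro n
    rcases le_total n N with h | h
    · intro a ha
      rw [hv0 n h, up_u _ _ (by omega), (hN _ (by omega)).1 a ha, (hN _ (by omega)).2 a ha, sub_self]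
    · induction n, h using Int.leInduction with
      | base =>
        intro a ha
        rw [hv0 N le_rfl, up_u _ _ (by omega), (hN _ (by omega)).1 a ha, (hN _ (by omega)).2 a ha,
          sub_self]
      | succ n hn ih =>
        intro a ha
        rw [hvs n hn, (step n _ ih a ha).2, add_sub_cancel_right]
  have hvR : ∀ n, combinatorialR (M + 1) κ (θ n) (v n, p n)
      = ((explicitR (v n, p n)).1, v (n + 1)) := by
    intro n
    rw [combinatorialR_apply]
    refine Prod.ext rfl (ext_up fun a h1 h2 => ?_)
    obtain ⟨a, rfl⟩ := Nat.exists_eq_add_of_le' h1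
    rw [(step n _ (hv n) a (by omega)).2, hv (n + 1) a (by omega), add_sub_cancel_right]
  have hq : IsTimeEvolution κ p fun n => (explicitR (v n, p n)).1 := by
    refine ⟨v, eventually_atBot.2 ⟨N, hv0⟩, ?_, hvR⟩
    obtain ⟨N', hN'⟩ := eventually_atTop.1 htop
    refine eventually_atTop.2 ⟨N' + 1, fun n hn => eq_u fun a h1 h2 => ?_⟩
    obtain ⟨a, rfl⟩ := Nat.exists_eq_add_of_le' h1
    rw [hv n a (by omega), hN' (n - 1) (by omega) a (by omega), sub_self]
  rw [T, IsTimeEvolution.unique (Classical.epsilon_spec ⟨_, hq⟩) hq]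
  exact ⟨fun n a ha => (step n _ (hv n) a ha).1, hF'⟩

end Automaton

namespace Automaton

open RowCrystal

variable {M : ℕ} {θ : ℤ → ℕ} {κ k l : ℕ}

/-! ### Phases of solitons -/

/-- The dependence on `n` of the phase of a soliton of amplitude `k`. -/
def IsPhase (θ : ℤ → ℕ) (k : ℕ) (ξ : ℤ → ℤ) : Prop :=
  ∀ n, ξ n = ξ (n - 1) + min (θ n : ℤ) k

theorem IsPhase.add_const {ξ : ℤ → ℤ} (h : IsPhase θ k ξ) (c : ℤ) :
    IsPhase θ k fun n => ξ n + c := fun n => by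
  have := h n
  dsimp only
  omega

theorem IsPhase.add_le {ξ : ℤ → ℤ} (h : IsPhase θ k ξ) (hθ : ∀ n, 0 < θ n) (hk : 0 < k) {m n : ℤ}
    (hmn : m ≤ n) : ξ m + (n - m) ≤ ξ n := by
  induction n, hmn using Int.leInduction with
  | base => simp
  | succ n _ ih =>
    have h1 := h (n + 1)
    have h2 := hθ (n + 1)
    rw [add_sub_cancel_right] at h1
    omega

theorem IsPhase.le_add {ξ : ℤ → ℤ} (h : IsPhase θ k ξ) {m n : ℤ} (hmn : m ≤ n) :
    ξ n ≤ ξ m + k * (n - m) := by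
  induction n, hmn using Int.leInduction with
  | base => simp
  | succ n _ ih =>
    have h1 := h (n + 1)
    rw [add_sub_cancel_right] at h1
    have h2 : (k : ℤ) * (n + 1 - m) = k * (n - m) + k := by ring
    omega

theorem IsPhase.eventually_le {ξ : ℤ → ℤ} (h : IsPhase θ k ξ) (hθ : ∀ n, 0 < θ n) (hk : 0 < k)
    (c : ℤ) : ∀ᶠ n in atBot, ξ n ≤ c := by
  filter_upwards [eventually_le_atBot 0, eventually_le_atBot (c - ξ 0)] with n h1 h2
  have := h.add_le hθ hk h1
  omega

theorem IsPhase.eventually_ge {ξ : ℤ → ℤ} (h : IsPhase θ k ξ) (hθ : ∀ n, 0 < θ n) (hk : 0 < k)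
    (c : ℤ) : ∀ᶠ n in atTop, c ≤ ξ n := by
  filter_upwards [eventually_ge_atTop 0, eventually_ge_atTop (c - ξ 0)] with n h1 h2
  have := h.add_le hθ hk h1
  omega

theorem exists_crossing {f : ℤ → ℤ} (hf : ∀ m n, m ≤ n → f m + (n - m) ≤ f n) :
    ∃ n, f (n - 1) ≤ 0 ∧ 0 < f n := by
  obtain ⟨n, h1, h2⟩ := Int.exists_least_of_bdd (P := fun n => 0 < f n)
    ⟨-|f 0|, fun n hn => by
      rcases le_total n 0 with h | h
      · have := hf n 0 h
        have := le_abs_self (f 0)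
        omega
      · have := abs_nonneg (f 0)
        omega⟩
    ⟨|f 0| + 1, by
      have := hf 0 (|f 0| + 1) (by positivity)
      have := neg_abs_le (f 0)
      omega⟩
  refine ⟨n, not_lt.1 fun h => ?_, h1⟩
  have := h2 _ h
  omega

/-- Truncation of an integer to the interval `[0, m]`. -/
def clamp (x m : ℤ) : ℤ := min (max x 0) m

/-- Agreement at the full amplitude suffices for the counts of all letters of a soliton. -/
theorem clamp_congr {x y m m' : ℤ} (h : clamp x m = clamp y m) (hm : m' ≤ m) :
    clamp x m' = clamp y m' := by
  unfold clamp at *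
  omega

theorem boxStart_add_le (hθ : ∀ n, 0 < θ n) {m n : ℤ} (h : m ≤ n) :
    boxStart θ m + (n - m) ≤ boxStart θ n := by
  induction n, h using Int.leInduction with
  | base => simp
  | succ n _ ih =>
    have h1 := boxStart_succ θ n
    have h2 := hθ n
    omega

/-- Phase and cell position advance by different amounts in a box with more than `k` cells, but
after truncation at `k` this is invisible. It suffices that they agree in the box `n₀` where the
soliton starts. -/
theorem clamp_boxStart_eq {ξ : ℤ → ℤ} (h : IsPhase θ k ξ) (hθ : ∀ n, 0 < θ n) (hk : 0 < k)
    {x n₀ : ℤ} (h1 : boxStart θ n₀ ≤ x) (h2 : ξ (n₀ - 1) ≤ 0) (h3 : x < boxStart θ (n₀ + 1))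
    (h4 : 0 < ξ n₀) (h5 : min (boxStart θ (n₀ + 1) - x) k = min (ξ n₀) k) (n : ℤ) :
    clamp (boxStart θ (n + 1) - x) k = clamp (ξ n) k := by
  rcases lt_or_ge n n₀ with hn | hn
  · have h6 := h.add_le hθ hk (show n ≤ n₀ - 1 by omega)
    have h7 := boxStart_add_le hθ (show n + 1 ≤ n₀ by omega)
    unfold clamp
    omega
  · suffices x < boxStart θ (n + 1) ∧ 0 < ξ n ∧ min (boxStart θ (n + 1) - x) k = min (ξ n) k by
      unfold clamp
      omega
    induction n, hn using Int.leInduction with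
    | base => exact ⟨h3, h4, h5⟩
    | succ n _ ih =>
      have h6 := h (n + 1)
      have h7 := boxStart_succ θ (n + 1)
      have h8 := hθ (n + 1)
      rw [add_sub_cancel_right] at h6
      omega

/-- The phase of a soliton that starts at a given cell. -/
theorem exists_phase (hθ : ∀ n, 0 < θ n) (hk : 0 < k) (x : ℤ) :
    ∃ ξ, IsPhase θ k ξ ∧ ∀ n, clamp (boxStart θ (n + 1) - x) k = clamp (ξ n) k := by
  obtain ⟨n₀, h1, h2⟩ := exists_crossing (f := fun n => boxStart θ (n + 1) - x) fun m n h => by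
    have := boxStart_add_le hθ (show m + 1 ≤ n + 1 by omega)
    omega
  rw [sub_add_cancel] at h1
  have h3 := boxStart_succ θ n₀
  have hph : IsPhase θ k fun n => boxStart (fun n => min (θ n) k) (n + 1)
      + (min (boxStart θ (n₀ + 1) - x) k - boxStart (fun n => min (θ n) k) (n₀ + 1)) := fun n => by
    have := boxStart_succ (fun n => min (θ n) k) n
    dsimp only
    rw [sub_add_cancel]
    omega
  refine ⟨_, hph, clamp_boxStart_eq hph hθ hk (n₀ := n₀) (by omega) ?_ (by omega) ?_ ?_⟩
  · have := hph n₀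
    dsimp only at *
    omega
  · omega
  · omega

/-- The cell at which a soliton with a given phase starts. -/
theorem exists_position {ξ : ℤ → ℤ} (h : IsPhase θ k ξ) (hθ : ∀ n, 0 < θ n) (hk : 0 < k) :
    ∃ x, ∀ n, clamp (boxStart θ (n + 1) - x) k = clamp (ξ n) k := by
  obtain ⟨n₀, h1, h2⟩ := exists_crossing fun m n => h.add_le hθ hk (m := m) (n := n)
  have h3 := h n₀
  have h4 := boxStart_succ θ n₀
  exact ⟨boxStart θ (n₀ + 1) - ξ n₀, clamp_boxStart_eq h hθ hk (n₀ := n₀) (by omega) h1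
    (by omega) h2 (by omega)⟩

/-! ### Evolution of the two soliton tau function -/

/-- The tau function of two solitons that are labelled by `z` before their collision, and by the
image of `z` under the combinatorial `R` matrix afterwards. -/
def solitonTau (z : RowCrystal M l × RowCrystal M k) [NeZero M] (a : ℕ) (ξ ζ : ℤ) : ℤ :=
  tau (z.1.up a) ((explicitR z).1.up a) (k - cut z 0 + z.1.up a + z.2.up a) ξ ζ

/-- The number of letters greater than `a` that belongs to the tau function of two solitons. -/
def solitonCount [NeZero M] (z : RowCrystal M l × RowCrystal M k) (ξ ζ : ℤ → ℤ) (n : ℤ) (a : ℕ) : ℤ :=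
  solitonTau z M (ξ n) (ζ n) - solitonTau z a (ξ n) (ζ n)

variable [NeZero M]

theorem up_mem (z : RowCrystal M l × RowCrystal M k) (a : ℕ) :
    (0 ≤ z.1.up a ∧ z.1.up a ≤ l) ∧ (0 ≤ z.2.up a ∧ z.2.up a ≤ k) ∧
    (0 ≤ (explicitR z).1.up a ∧ (explicitR z).1.up a ≤ k) ∧
    (0 ≤ (explicitR z).2.up a ∧ (explicitR z).2.up a ≤ l) ∧
    (explicitR z).1.up a + (explicitR z).2.up a = z.1.up a + z.2.up a :=
  ⟨⟨up_nonneg _ _, up_le _ _⟩, ⟨up_nonneg _ _, up_le _ _⟩, ⟨up_nonneg _ _, up_le _ _⟩,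
    ⟨up_nonneg _ _, up_le _ _⟩, up_explicitR_add z a⟩

theorem solitonTau_last (z : RowCrystal M l × RowCrystal M k) (ξ ζ : ℤ) :
    solitonTau z M ξ ζ = tau 0 0 (k - cut z 0) ξ ζ := by
  simp only [solitonTau, up_of_le _ le_rfl, add_zero]

/-- For `a = 0` the letter counts are the full lengths, which amount to shifts of the phases. This
turns the terms for the occupied cells of a box into tau functions one time step later. -/
theorem solitonTau_zero (z : RowCrystal M l × RowCrystal M k) (ξ ζ : ℤ) :
    solitonTau z 0 ξ ζ = solitonTau z M (ξ - l) (ζ - k) := by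
  rw [solitonTau_last]
  simp only [solitonTau, up_zero, tau]
  omega

/-- Passing from `a + 1` to `a` adds the multiplicities of one letter to the parameters. The
constraint of `tau_bilinear` between the increments of `β` and `γ` is `explicitR_fst_eq_min`. -/
theorem solitonTau_bilinear (z : RowCrystal M l × RowCrystal M k) (hkl : k ≤ l) (t : ℕ) {a : ℕ}
    (ha : a < M) (ξ ζ : ℤ) :
    solitonTau z a (ξ + min (t : ℤ) l - l) (ζ + min (t : ℤ) k - k) + solitonTau z (a + 1) ξ ζ
      = max (solitonTau z (a + 1) (ξ + min (t : ℤ) l - l) (ζ + min (t : ℤ) k - k)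
          + solitonTau z a ξ ζ)
        (solitonTau z a (ξ - l) (ζ - k)
          + solitonTau z (a + 1) (ξ + min (t : ℤ) l) (ζ + min (t : ℤ) k) - t) := by
  have h1 := z.1.up_eq_succ ⟨a, ha⟩
  have h2 := z.2.up_eq_succ ⟨a, ha⟩
  have h3 := (explicitR z).1.up_eq_succ ⟨a, ha⟩
  have h4 := explicitR_fst_eq_min z hkl ⟨a, ha⟩
  have h5 := z.1.up_nonneg (a + 1)
  have h6 := z.1.up_le a
  dsimp only at h1 h2 h3 h4
  simp only [solitonTau]
  rw [h1, h2, h3, show (k : ℤ) - cut z 0 + (z.1.up (a + 1) + z.1.mult ⟨a, ha⟩)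
    + (z.2.up (a + 1) + z.2.mult ⟨a, ha⟩) = k - cut z 0 + z.1.up (a + 1) + z.2.up (a + 1)
      + z.1.mult ⟨a, ha⟩ + z.2.mult ⟨a, ha⟩ by ring]
  refine tau_bilinear (by omega) (by omega) (by omega) (by omega) (by omega) (by omega) (by omega)
    ?_ rfl rfl
  rw [h4]
  congr 1
  ring

theorem solitonCount_eq_zero (z : RowCrystal M l × RowCrystal M k) {ξ ζ : ℤ → ℤ} {n : ℤ}
    (h1 : ξ n ≤ 0) (h2 : ζ n ≤ 0) (a : ℕ) : solitonCount z ξ ζ n a = 0 := by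
  have h3 := up_mem z a
  have h4 := cut_zero_mem z
  rw [solitonCount, solitonTau_last, solitonTau, tau, tau]
  omega

theorem solitonCount_eq_of_ge (z : RowCrystal M l × RowCrystal M k) {ξ ζ : ℤ → ℤ} {n : ℤ}
    (h1 : 3 * k + l ≤ ξ n) (h2 : 3 * k + l ≤ ζ n) (a : ℕ) :
    solitonCount z ξ ζ n a = z.1.up a + z.2.up a := by
  have h3 := up_mem z a
  have h4 := cut_zero_mem z
  rw [solitonCount, solitonTau_last, solitonTau, tau, tau]
  omega

theorem solitonCount_zero_mem (z : RowCrystal M l × RowCrystal M k) (ξ ζ : ℤ → ℤ) (n : ℤ) :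
    0 ≤ solitonCount z ξ ζ n 0 ∧ solitonCount z ξ ζ n 0 ≤ l + k := by
  rw [solitonCount, solitonTau_zero, solitonTau_last, solitonTau_last, tau, tau]
  omega

/-- The time evolution of a state of two solitons. -/
theorem timeEvolution_solitonCount (z : RowCrystal M l × RowCrystal M k) (hk : 0 < k) (hkl : k ≤ l)
    (hκ : 2 * l ≤ κ) (hθ : ∀ n, 0 < θ n) {ξ ζ : ℤ → ℤ} (hξ : IsPhase θ l ξ) (hζ : IsPhase θ k ζ)
    {p : State M θ} (hp : HasProfile p (solitonCount z ξ ζ)) :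
    HasProfile (T κ p) (solitonCount z (fun n => ξ n - l) fun n => ζ n - k) := by
  have hl : 0 < l := hk.trans_le hkl
  refine hp.timeEvolution ?_ ?_ (fun n => ?_) (fun n => ?_) fun n a ha => ?_
  · filter_upwards [hξ.eventually_le hθ hl 0, hζ.eventually_le hθ hk 0] with n h1 h2 a _
    exact solitonCount_eq_zero z (by omega) (by omega) a
  · filter_upwards [hξ.eventually_ge hθ hl (3 * k + l + l),
      hζ.eventually_ge hθ hk (3 * k + l + k)] with n h1 h2 a _
    rw [solitonCount_eq_of_ge z (by omega) (by omega),
      solitonCount_eq_of_ge z (by omega) (by omega)]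
  · simp [solitonCount]
  · have h1 := solitonCount_zero_mem z ξ ζ n
    have h2 := solitonCount_zero_mem z (fun n => ξ n - l) (fun n => ζ n - k) (n - 1)
    omega
  · have h1 := solitonTau_bilinear z hkl (θ n) ha (ξ (n - 1)) (ζ (n - 1))
    rw [← hξ n, ← hζ n] at h1
    simp only [solitonCount, solitonTau_zero]
    omega

end Automaton

namespace Automaton

open RowCrystal

variable {M : ℕ} {θ : ℤ → ℕ} {k l : ℕ}

/-! ### Words -/

/-- In a weakly decreasing word the large letters form an initial segment. Positions beyond the word
return the default 0, which is below `v` as `1 ≤ v`. -/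
theorem le_getD_iff {N : ℕ} [NeZero N] {v : ℕ} (hv : 1 ≤ v) {w : List (Fin N)}
    (hw : w.Pairwise (· ≥ ·)) (i : ℕ) :
    v ≤ (w.getD i 0).val ↔ i < w.countP fun a => v ≤ a.val := by
  induction w generalizing i with
  | nil => simp; omega
  | cons h t ih =>
    rw [List.pairwise_cons] at hw
    by_cases hh : v ≤ h.val
    · rw [List.countP_cons_of_pos (by simpa using hh)]
      cases i with
      | zero => simpa using hh
      | succ i =>
        rw [List.getD_cons_succ, ih hw.2]
        omega
    · rw [List.countP_cons_of_neg (by simpa using hh)]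
      have h0 : (t.countP fun a => v ≤ a.val) = 0 := by
        rw [List.countP_eq_zero]
        intro a ha
        have : a.val ≤ h.val := hw.1 a ha
        simp only [decide_eq_true_eq]
        omega
      cases i with
      | zero => simp [h0]; omega
      | succ i => rw [List.getD_cons_succ, ih hw.2, h0]; simp

theorem countP_row (b : RowCrystal M k) (a : ℕ) :
    ((b.row.countP fun j => a ≤ j.val : ℕ) : ℤ) = b.up a := by
  rw [RowCrystal.row, List.countP_flatMap, up, psum]
  have h1 : ((List.finRange M).map
      (List.countP (fun j : Fin M => decide (a ≤ j.val)) ∘ fun j => List.replicate (b.mult j) j))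
      = (List.finRange M).map fun j => if a ≤ j.val then b.mult j else 0 := by
    refine List.map_congr_left fun j _ => ?_
    simp [List.countP_replicate]
  rw [h1, ← List.ofFn_eq_map, List.sum_ofFn]
  have h2 : (k : ℤ) = ∑ j, (b.mult j : ℤ) := by exact_mod_cast b.sum_mult.symm
  rw [h2]
  push_cast
  rw [← Finset.sum_sub_distrib]
  refine Finset.sum_congr rfl fun j _ => ?_
  split_ifs <;> omega

theorem length_row (b : RowCrystal M k) : b.row.length = k := by
  have h := countP_row b 0
  rw [up_zero, List.countP_eq_length.2 (by simp)] at h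
  exact_mod_cast h

theorem pairwise_row (b : RowCrystal M k) : b.row.Pairwise (· ≤ ·) := by
  rw [RowCrystal.row, List.pairwise_flatMap]
  refine ⟨fun a _ => by simp [List.pairwise_replicate], ?_⟩
  refine (List.pairwise_lt_finRange M).imp fun {a c} hac x hx y hy => ?_
  rw [List.eq_of_mem_replicate hx, List.eq_of_mem_replicate hy]
  exact hac.le

theorem length_solitonWord (b : RowCrystal M k) : (solitonWord b).length = k := by
  simp [solitonWord, length_row]

theorem lt_getD_solitonWord_iff (b : RowCrystal M k) (a i : ℕ) :
    a < ((solitonWord b).getD i 0).val ↔ (i : ℤ) < b.up a := by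
  have h : (solitonWord b).Pairwise (· ≥ ·) := by
    rw [solitonWord, List.pairwise_map, List.pairwise_reverse]
    exact (pairwise_row b).imp fun h => Fin.succ_le_succ_iff.2 h
  rw [← Nat.succ_le_iff, le_getD_iff (Nat.succ_pos a) h, ← countP_row, solitonWord, List.countP_map,
    List.countP_reverse]
  norm_cast
  refine iff_of_eq (congrArg _ (List.countP_congr fun j _ => ?_))
  simp

theorem lt_place_iff (x j : ℤ) (L : ℕ) (b : RowCrystal M k) (c : RowCrystal M l) (a : ℕ) :
    a < (place x (solitonWord b ++ List.replicate L 0 ++ solitonWord c) j).val ↔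
      (x ≤ j ∧ j < x + b.up a) ∨ (x + k + L ≤ j ∧ j < x + k + L + c.up a) := by
  have hb := b.up_le a
  have hc := c.up_nonneg a
  unfold place
  split_ifs with h
  · simp only [Fin.val_zero]; omega
  · have hlen := length_solitonWord b
    have hlen' : (solitonWord b ++ List.replicate L (0 : Fin (M + 1))).length = k + L := by
      simp [hlen]
    rcases Nat.lt_or_ge (j - x).toNat (k + L) with h1 | h1
    · rw [List.getD_append _ _ _ _ (by omega)]
      rcases Nat.lt_or_ge (j - x).toNat k with h2 | h2
      · rw [List.getD_append _ _ _ _ (by omega), lt_getD_solitonWord_iff]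
        omega
      · rw [List.getD_append_right _ _ _ _ (by omega), List.getD_replicate _ (by omega)]
        simp only [Fin.val_zero]; omega
    · rw [List.getD_append_right _ _ _ _ (by omega), lt_getD_solitonWord_iff, hlen']
      omega

/-! ### Profiles of separated states -/

theorem up_group (θ : ℤ → ℕ) (w : ℤ → Fin (M + 1)) (n : ℤ) (a : ℕ) :
    (group θ w n).up (a + 1)
      = ∑ j ∈ Finset.Ico (boxStart θ n) (boxStart θ n + θ n), if a < (w j).val then (1 : ℤ) else 0 := by
  have h1 : (θ n : ℤ) = ∑ j ∈ Finset.Ico (boxStart θ n) (boxStart θ n + θ n), (1 : ℤ) := by simp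
  rw [up, psum, group]
  have h2 : ∀ i : Fin (M + 1), (if i.val < a + 1 then
      ((((Finset.Ico (boxStart θ n) (boxStart θ n + θ n)).filter fun j => w j = i).card : ℕ) : ℤ)
        else 0) = ∑ j ∈ Finset.Ico (boxStart θ n) (boxStart θ n + θ n),
          if w j = i then (if i.val < a + 1 then (1 : ℤ) else 0) else 0 := by
    intro i
    split_ifs with h
    · rw [Finset.card_filter]; push_cast; rfl
    · simp
  simp only [h2]
  refine (congrArg (· - _) h1).trans ?_
  rw [Finset.sum_comm, ← Finset.sum_sub_distrib]
  refine Finset.sum_congr rfl fun j _ => ?_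
  rw [Finset.sum_ite_eq, if_pos (Finset.mem_univ _)]
  split_ifs <;> omega

theorem sum_Ico_int_sub (g : ℤ → ℤ) (s : ℤ) (t : ℕ) :
    ∑ j ∈ Finset.Ico s (s + t), (g (j + 1) - g j) = g (s + t) - g s := by
  induction t with
  | zero => simp
  | succ t ih =>
    have h : Finset.Ico s (s + (t + 1 : ℕ)) = insert (s + t : ℤ) (Finset.Ico s (s + t)) := by
      ext a; simp only [Finset.mem_Ico, Finset.mem_insert]; omega
    rw [h, Finset.sum_insert (by simp), ih]
    push_cast
    rw [add_assoc s]
    ring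

/-- As the words are weakly decreasing, the letters greater than `a` fill an interval of `up a`
cells from the start of each word. The claimed profile telescopes over the cells of a box. -/
theorem hasProfile_twoSoliton (hθ : ∀ n, 0 < θ n) (x : ℤ) (L : ℕ)
    (b : RowCrystal M k × RowCrystal M l) :
    HasProfile (twoSoliton θ x L b) fun n a => clamp (boxStart θ (n + 1) - x) (b.1.up a)
      + clamp (boxStart θ (n + 1) - (x + k + L)) (b.2.up a) := by
  constructor
  · intro n a _
    have hb := b.1.up_le a
    have hb' := b.1.up_nonneg a
    have hc := b.2.up_nonneg a
    dsimp only
    rw [twoSoliton, up_group, sub_add_cancel, boxStart_succ, ← sum_Ico_int_sub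
      (fun y => clamp (y - x) (b.1.up a) + clamp (y - (x + k + L)) (b.2.up a))]
    refine Finset.sum_congr rfl fun j _ => ?_
    have := lt_place_iff x j L b.1 b.2 a
    by_cases h : a < (place x (solitonWord b.1 ++ List.replicate L 0 ++ solitonWord b.2) j).val
    · rw [if_pos h]
      have := this.1 h
      simp only [clamp]
      omega
    · rw [if_neg h]
      rw [this] at h
      simp only [clamp]
      omega
  · filter_upwards [eventually_le_atBot (-1 : ℤ), eventually_le_atBot (x - boxStart θ 0 - 1)]
      with n h1 h2 a _
    have := boxStart_add_le hθ (show n + 1 ≤ 0 by omega)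
    have hb' := b.1.up_nonneg a
    have hc := b.2.up_nonneg a
    simp only [clamp]
    omega

/-- Separated states in terms of profiles. -/
theorem isSeparated_iff (hθ : ∀ n, 0 < θ n) {D : ℕ} (hD : 1 ≤ D)
    {b : RowCrystal M k × RowCrystal M l} {p : State M θ} :
    IsSeparated θ D b p ↔ ∃ x y r s : ℤ,
      HasProfile p (fun n a => clamp (boxStart θ (n + 1) - x) (b.1.up a)
        + clamp (boxStart θ (n + 1) - y) (b.2.up a)) ∧
      x + k ≤ boxStart θ (r + 1) ∧ boxStart θ s ≤ y ∧ r + D ≤ s := by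
  constructor
  · rintro ⟨x, L, r, s, rfl, h1, h2, h3⟩
    exact ⟨x, x + k + L, r, s, hasProfile_twoSoliton hθ x L b, h1, h2, h3⟩
  · rintro ⟨x, y, r, s, h0, h1, h2, h3⟩
    have h4 := boxStart_add_le hθ (show r + 1 ≤ s by omega)
    obtain ⟨L, hL⟩ := Int.le.dest (show x + k ≤ y by omega)
    subst hL
    exact ⟨x, L, r, s, h0.state_eq (hasProfile_twoSoliton hθ x L b), h1, h2, h3⟩

theorem exists_isSeparated (hθ : ∀ n, 0 < θ n) (D : ℕ) (b : RowCrystal M k × RowCrystal M l) :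
    ∃ p : State M θ, IsSeparated θ D b p := by
  have h1 := boxStart_add_le hθ (show (0 : ℤ) ≤ k + 1 by positivity)
  have h2 := boxStart_add_le hθ (show (0 : ℤ) ≤ k + D by positivity)
  have h0 : boxStart θ 0 = 0 := by simp [boxStart]
  refine ⟨_, 0, (boxStart θ (k + D)).toNat, k, k + D, rfl, by omega, by omega, le_rfl⟩

theorem IsSeparated.mono {D D' : ℕ} (h : D ≤ D') {b : RowCrystal M k × RowCrystal M l}
    {p : State M θ} (hp : IsSeparated θ D' b p) : IsSeparated θ D b p := by
  obtain ⟨x, L, r, s, h0, h1, h2, h3⟩ := hp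
  exact ⟨x, L, r, s, h0, h1, h2, by omega⟩

/-- The label of a separated state is determined by the state. -/
theorem IsSeparated.label_eq (hθ : ∀ n, 0 < θ n) {D D' : ℕ} (hD : 1 ≤ D) (hD' : 1 ≤ D')
    {b c : RowCrystal M k × RowCrystal M l} {p : State M θ} (hb : IsSeparated θ D b p)
    (hc : IsSeparated θ D' c p) : b = c := by
  obtain ⟨x, y, r, s, h0, h1, h2, h3⟩ := (isSeparated_iff hθ hD).1 hb
  obtain ⟨x', y', r', s', h0', h1', h2', h3'⟩ := (isSeparated_iff hθ hD').1 hc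
  have h4 := boxStart_add_le hθ (show r + 1 ≤ s by omega)
  have h4' := boxStart_add_le hθ (show r' + 1 ≤ s' by omega)
  have hF := fun a ha n => h0.eq h0' (a := a) ha n
  have e1 : ∀ a, clamp (boxStart θ (r + 1) - x) (b.1.up a)
      + clamp (boxStart θ (r + 1) - y) (b.2.up a) = b.1.up a := fun a => by
    have h5 := b.1.up_le a
    have h6 := b.1.up_nonneg a
    have h7 := b.2.up_nonneg a
    simp only [clamp]
    omega
  have e2 : ∀ a, clamp (boxStart θ (r' + 1) - x') (c.1.up a)
      + clamp (boxStart θ (r' + 1) - y') (c.2.up a) = c.1.up a := fun a => by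
    have h5 := c.1.up_le a
    have h6 := c.1.up_nonneg a
    have h7 := c.2.up_nonneg a
    simp only [clamp]
    omega
  -- The boxes up to `r`, and likewise those up to `r'`, contain exactly `k` letters greater than 0.
  -- Hence nothing but letters 0 lies between, and the counts for every `a` agree.
  have hfst : ∀ a, a ≤ M → b.1.up a = c.1.up a := by
    intro a ha
    have hz := hF 0 (Nat.zero_le _) r'
    have hz' := hF a ha r'
    rw [e2] at hz hz'
    have g1 := e1 a
    have g0 := e1 0
    rcases le_total r r' with h | h
    · have h5 := h0.mono ha h
      simp only [up_zero] at g0 hz h5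
      omega
    · have h5 := h0.mono ha h
      simp only [up_zero] at g0 hz h5
      omega
  have hsnd : ∀ a, a ≤ M → b.2.up a = c.2.up a := by
    intro a ha
    let N : ℤ := |x| + |y| + |x'| + |y'| + k + l + |boxStart θ 0|
    have h5 := boxStart_add_le hθ (show 0 ≤ N + 1 by positivity)
    have h6 : x + k ≤ boxStart θ (N + 1) ∧ y + l ≤ boxStart θ (N + 1) ∧
        x' + k ≤ boxStart θ (N + 1) ∧ y' + l ≤ boxStart θ (N + 1) := by
      have := le_abs_self x
      have := le_abs_self y
      have := le_abs_self x'
      have := le_abs_self y'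
      have := neg_abs_le (boxStart θ 0)
      have := abs_nonneg x
      have := abs_nonneg y
      have := abs_nonneg x'
      have := abs_nonneg y'
      refine ⟨?_, ?_, ?_, ?_⟩ <;> simp only [N] at h5 ⊢ <;> omega
    have h7 := hF a ha N
    have h8 := hfst a ha
    have := b.1.up_le a
    have := b.1.up_nonneg a
    have := b.2.up_le a
    have := b.2.up_nonneg a
    have := c.2.up_le a
    have := c.2.up_nonneg a
    simp only [clamp] at h7
    omega
  exact Prod.ext (ext_up fun a _ h => hfst a h.le) (ext_up fun a _ h => hsnd a h.le)

end Automaton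

/-! ### Asymptotic states and the scattering matrix. -/

namespace Automaton

open RowCrystal

variable {M : ℕ} [NeZero M] {θ : ℤ → ℕ} {κ k l : ℕ}

/-- Only two of the four terms of each tau function survive: those without `ζ` if `ζ n ≤ 0`, those
with `ξ` if `ξ n` is large. What remains is a sum of one-soliton counts `max 0 ξ - max 0 (ξ - β) =
clamp ξ β`. -/
theorem solitonCount_of_incoming (z : RowCrystal M l × RowCrystal M k) {ξ ζ : ℤ → ℤ} {n : ℤ}
    (h : ζ n ≤ 0 ∨ 2 * k + l - cut z 0 ≤ ξ n) (a : ℕ) :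
    solitonCount z ξ ζ n a
      = clamp (ξ n) (z.1.up a) + clamp (ζ n - (k - cut z 0)) (z.2.up a) := by
  have h3 := up_mem z a
  have h4 := cut_zero_mem z
  rw [solitonCount, solitonTau_last, solitonTau]
  generalize cut z 0 = d at *
  generalize z.1.up a = β at *
  generalize z.2.up a = γ at *
  rcases h with h | h
  · rw [show tau 0 0 (k - d) (ξ n) (ζ n) = max 0 (ξ n) by unfold tau; omega,
      show tau β ((explicitR z).1.up a) (k - d + β + γ) (ξ n) (ζ n) = max 0 (ξ n - β) by
        unfold tau; omega]
    unfold clamp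
    omega
  · rw [show tau 0 0 (k - d) (ξ n) (ζ n) = max (ξ n) (ξ n + ζ n - (k - d)) by unfold tau; omega,
      show tau β ((explicitR z).1.up a) (k - d + β + γ) (ξ n) (ζ n)
        = max (ξ n - β) (ξ n + ζ n - (k - d + β + γ)) by unfold tau; omega]
    unfold clamp
    omega

/-- The same with the phases exchanged. The left soliton now shows `γ`, the count for the first
factor of the image under R; conservation of letters gives the second factor. -/
theorem solitonCount_of_outgoing (z : RowCrystal M l × RowCrystal M k) {ξ ζ : ℤ → ℤ} {n : ℤ}
    (h : ξ n ≤ 0 ∨ 2 * k + l - cut z 0 ≤ ζ n) (a : ℕ) :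
    solitonCount z ξ ζ n a = clamp (ζ n) ((explicitR z).1.up a)
      + clamp (ξ n - (k - cut z 0)) ((explicitR z).2.up a) := by
  have h3 := up_mem z a
  have h4 := cut_zero_mem z
  rw [solitonCount, solitonTau_last, solitonTau]
  generalize cut z 0 = d at *
  obtain ⟨δ, hδ⟩ : ∃ δ, z.1.up a + z.2.up a = δ := ⟨_, rfl⟩
  rw [add_assoc, hδ]
  rw [hδ] at h3
  generalize z.1.up a = β at *
  generalize (explicitR z).1.up a = γ at *
  rcases h with h | h
  · rw [show tau 0 0 (k - d) (ξ n) (ζ n) = max 0 (ζ n) by unfold tau; omega,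
      show tau β γ (k - d + δ) (ξ n) (ζ n) = max 0 (ζ n - γ) by unfold tau; omega]
    unfold clamp
    omega
  · rw [show tau 0 0 (k - d) (ξ n) (ζ n) = max (ζ n) (ξ n + ζ n - (k - d)) by unfold tau; omega,
      show tau β γ (k - d + δ) (ξ n) (ζ n) = max (ζ n - γ) (ξ n + ζ n - (k - d + δ)) by
        unfold tau; omega]
    unfold clamp
    omega

/-- In a separated state the phase of the left soliton is large wherever the phase of the right
soliton is not very negative. -/
theorem phase_of_separated (hθ : ∀ n, 0 < θ n) {k₁ k₂ : ℕ} (h₁ : 0 < k₁) (h₂ : 0 < k₂) {ξ ζ : ℤ → ℤ}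
    (hξ : IsPhase θ k₁ ξ) (hζ : IsPhase θ k₂ ζ) {x y r s : ℤ}
    (hx : ∀ n, clamp (boxStart θ (n + 1) - x) k₁ = clamp (ξ n) k₁)
    (hy : ∀ n, clamp (boxStart θ (n + 1) - y) k₂ = clamp (ζ n) k₂)
    (hr : x + k₁ ≤ boxStart θ (r + 1)) (hs : boxStart θ s ≤ y) {d : ℤ} (hd : 0 ≤ d) {D : ℕ}
    (hD : r + D ≤ s) (n : ℤ) (hn : -d < ζ n) (hdD : d < D) : k₁ + D - d ≤ ξ n := by
  have h1 : k₁ ≤ ξ r := by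
    have := hx r
    unfold clamp at this
    omega
  have h2 : ζ (s - 1) ≤ 0 := by
    have := hy (s - 1)
    rw [sub_add_cancel] at this
    unfold clamp at this
    omega
  have h3 : s - d ≤ n := by
    by_contra! h
    have := hζ.add_le hθ h₂ (show n ≤ s - 1 by omega)
    omega
  have := hξ.add_le hθ h₁ (show r ≤ n by omega)
  omega

/-- Here `ζ` is the phase of the right soliton advanced by the shift `k - cut z 0 ≤ 2 * k`. Where it
is positive, a separation of `6 * l` boxes lifts `ξ` above the threshold of
`solitonCount_of_incoming`. -/
theorem exists_solitonCount_of_incoming (z : RowCrystal M l × RowCrystal M k) (hk : 0 < k)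
    (hkl : k < l) (hθ : ∀ n, 0 < θ n) {p : State M θ} (h : IsSeparated θ (6 * l) z p) :
    ∃ ξ ζ, IsPhase θ l ξ ∧ IsPhase θ k ζ ∧ HasProfile p (solitonCount z ξ ζ) := by
  obtain ⟨x, y, r, s, hp, hr, hs, hD⟩ := (isSeparated_iff hθ (by omega)).1 h
  obtain ⟨ξ, hξ, hx⟩ := exists_phase hθ (hk.trans hkl) x
  obtain ⟨ζ, hζ, hy⟩ := exists_phase hθ hk y
  have h4 := cut_zero_mem z
  refine ⟨ξ, fun n => ζ n + (k - cut z 0), hξ, hζ.add_const _, ?_⟩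
  convert hp using 1
  funext n a
  rw [solitonCount_of_incoming z (by
      by_contra! hcon
      have := phase_of_separated hθ (hk.trans hkl) hk hξ hζ hx hy hr hs
        (d := k - cut z 0) (by omega) hD n (by omega) (by push_cast; omega)
      push_cast at this
      omega) a,
    clamp_congr (hx n) (z.1.up_le a), clamp_congr (hy n) (z.2.up_le a)]
  congr 2
  ring

theorem exists_solitonCount_of_outgoing (z : RowCrystal M l × RowCrystal M k) (hk : 0 < k)
    (hkl : k < l) (hθ : ∀ n, 0 < θ n) {p : State M θ}
    (h : IsSeparated θ (6 * l) (explicitR z) p) :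
    ∃ ξ ζ, IsPhase θ l ξ ∧ IsPhase θ k ζ ∧ HasProfile p (solitonCount z ξ ζ) := by
  obtain ⟨x, y, r, s, hp, hr, hs, hD⟩ := (isSeparated_iff hθ (by omega)).1 h
  obtain ⟨ξ, hξ, hx⟩ := exists_phase hθ (hk.trans hkl) y
  obtain ⟨ζ, hζ, hy⟩ := exists_phase hθ hk x
  have h4 := cut_zero_mem z
  refine ⟨fun n => ξ n + (k - cut z 0), ζ, hξ.add_const _, hζ, ?_⟩
  convert hp using 1
  funext n a
  rw [solitonCount_of_outgoing z (by
      by_contra! hcon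
      have := phase_of_separated hθ hk (hk.trans hkl) hζ hξ hy hx hr hs
        (d := k - cut z 0) (by omega) hD n (by omega) (by push_cast; omega)
      push_cast at this
      omega) a,
    clamp_congr (hx n) ((explicitR z).2.up_le a), clamp_congr (hy n) ((explicitR z).1.up_le a)]
  congr 2
  ring

/-- The soliton of larger amplitude overtakes the other one by an arbitrary distance. -/
theorem eventually_phase_ge (hk : 0 < k) (hkl : k < l) (hθ : ∀ n, 0 < θ n)
    (hfin : {n : ℤ | l ≤ θ n}.Finite) {ξ ζ : ℤ → ℤ} (hξ : IsPhase θ l ξ) (hζ : IsPhase θ k ζ)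
    {C : ℤ} (hC : 0 ≤ C) :
    ∀ᶠ t : ℕ in atTop, ∀ n, -C < ξ n - l * t → C ≤ ζ n - k * t := by
  obtain ⟨N, hN⟩ := hfin.bddAbove
  -- Beyond `N` every box has `θ < l`, so `l * min θ k > k * θ`. In boxes with `θ ≥ l` both solitons
  -- would have the same speed and nothing would be gained.
  have hg : ∀ n, N ≤ n → l * ζ N - k * ξ N + (n - N) ≤ l * ζ n - k * ξ n := by
    intro n hn
    induction n, hn using Int.leInduction with
    | base => simp
    | succ n hn ih =>
      have h1 := hξ (n + 1)
      have h2 := hζ (n + 1)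
      have h3 := hθ (n + 1)
      have h4 : θ (n + 1) < l := by
        by_contra! h
        have := hN (show n + 1 ∈ {n : ℤ | l ≤ θ n} from h)
        omega
      rw [add_sub_cancel_right] at h1 h2
      rw [h1, h2, min_eq_left (show (θ (n + 1) : ℤ) ≤ l by omega)]
      have h5 : (k : ℤ) * θ (n + 1) + 1 ≤ l * min (θ (n + 1) : ℤ) k := by
        rcases le_total (θ (n + 1) : ℤ) k with h | h
        · rw [min_eq_left h]
          have : (0 : ℤ) < (l - k) * θ (n + 1) :=
            mul_pos (by omega) (by omega)
          nlinarith
        · rw [min_eq_right h]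
          have : (0 : ℤ) < k * (l - θ (n + 1)) :=
            mul_pos (by omega) (by omega)
          nlinarith
      nlinarith
  have hl : (1 : ℤ) ≤ l := by omega
  have hk' : (1 : ℤ) ≤ k := by omega
  -- After this time the boxes with `-C < ξ n - l * t` lie so far beyond `N` that `l * ζ - k * ξ`
  -- exceeds `l * C + k * C` there.
  obtain ⟨B, hB⟩ : ∃ B : ℤ, B = |ξ N| + C + l * (l * C + k * C + |l * ζ N - k * ξ N|) := ⟨_, rfl⟩
  filter_upwards [eventually_ge_atTop B.toNat] with t ht n hn
  have ht : B ≤ t := by omega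
  have a1 := le_abs_self (ξ N)
  have a2 := neg_abs_le (l * ζ N - k * ξ N)
  have a3 : 0 ≤ (l : ℤ) * (l * C + k * C + |l * ζ N - k * ξ N|) := by positivity
  have hlt : (t : ℤ) ≤ l * t := by nlinarith
  have hn' : N ≤ n := by
    by_contra! h
    have := hξ.add_le hθ (hk.trans hkl) h.le
    omega
  have h1 := hξ.le_add hn'
  have h2 := hg n hn'
  have h3 : l * C + k * C + |l * ζ N - k * ξ N| < n - N := by
    have : (l : ℤ) * (l * C + k * C + |l * ζ N - k * ξ N|) < l * (n - N) := by omega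
    exact lt_of_mul_lt_mul_left this (by omega)
  have h4 : l * C ≤ l * (ζ n - k * t) := by
    have h5 : (k : ℤ) * (-C) ≤ k * (ξ n - l * t) := mul_le_mul_of_nonneg_left hn.le (by omega)
    nlinarith
  exact le_of_mul_le_mul_left h4 (by omega)

/-- Any state of two solitons is eventually separated, with the label determined by the combinatorial
`R` matrix. -/
theorem eventually_isSeparated (z : RowCrystal M l × RowCrystal M k) (hk : 0 < k)
    (hkl : k < l) (hθ : ∀ n, 0 < θ n) (hfin : {n : ℤ | l ≤ θ n}.Finite) (hκ : 2 * l ≤ κ)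
    {ξ ζ : ℤ → ℤ} (hξ : IsPhase θ l ξ) (hζ : IsPhase θ k ζ) {p : State M θ}
    (hp : HasProfile p (solitonCount z ξ ζ)) (D : ℕ) :
    ∀ᶠ t : ℕ in atTop, IsSeparated θ (D + 1) (explicitR z) ((T κ)^[t] p) := by
  have hl : 0 < l := hk.trans hkl
  have hpt : ∀ t : ℕ, HasProfile ((T κ)^[t] p)
      (solitonCount z (fun n => ξ n + -(l * t)) fun n => ζ n + -(k * t)) := by
    intro t
    induction t with
    | zero => simpa using hp
    | succ t ih =>
      rw [Function.iterate_succ_apply']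
      convert timeEvolution_solitonCount z hk hkl.le hκ hθ (hξ.add_const _) (hζ.add_const _) ih
        using 3
      · push_cast; ring
      · push_cast; ring
  have h4 := cut_zero_mem z
  have hlD : 0 ≤ (l : ℤ) * (D + 1) := by positivity
  -- The part `2 * k + l - cut z 0` is the threshold of the outgoing regime. The part `l * (D + 1)`
  -- bounds the change of `ξ` over `D + 1` boxes, so the left soliton is complete that far before
  -- the box `s` where the right one starts.
  filter_upwards [eventually_phase_ge hk hkl hθ hfin hξ hζ
    (C := 2 * k + l - cut z 0 + l * (D + 1)) (by omega)] with t ht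
  obtain ⟨x, hx⟩ := exists_position (hζ.add_const (-(k * t))) hθ hk
  have hξt := hξ.add_const (-(l * t) - (k - cut z 0))
  obtain ⟨y, hy⟩ := exists_position hξt hθ hl
  obtain ⟨s, hs1, hs2⟩ := exists_crossing fun m n => hξt.add_le hθ hl (m := m) (n := n)
  refine (isSeparated_iff hθ (by omega)).2 ⟨x, y, s - (D + 1), s, ?_, ?_, ?_, by push_cast; omega⟩
  · convert hpt t using 1
    funext n a
    rw [solitonCount_of_outgoing z (by
        by_contra! hcon
        have := ht n (by omega)
        omega) a, clamp_congr (hx n) ((explicitR z).1.up_le a),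
      clamp_congr (hy n) ((explicitR z).2.up_le a)]
    congr 2
    ring
  · have h1 := hx (s - (D + 1))
    have h2 := hξ.le_add (show s - (D + 1) ≤ s by omega)
    rw [sub_sub_cancel] at h2
    have h3 := ht (s - (D + 1)) (by omega)
    unfold clamp at h1
    omega
  · have h1 := hy (s - 1)
    rw [sub_add_cancel] at h1
    unfold clamp at h1
    omega

/-- Any two predictions for the label are compared at a common late time, when the state is
separated and its label unique. -/
theorem isScatteringMatrix_iff (hk : 0 < k) (hkl : k < l) (hθ : ∀ n, 0 < θ n)
    (hfin : {n : ℤ | l ≤ θ n}.Finite) (hκ : 2 * l ≤ κ)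
    (S : RowCrystal M l × RowCrystal M k → RowCrystal M k × RowCrystal M l) :
    IsScatteringMatrix θ κ (6 * l) S ↔ S = combinatorialR M l k := by
  have key : ∀ (b : RowCrystal M l × RowCrystal M k) (p : State M θ),
      IsSeparated θ (6 * l) b p → ∀ D : ℕ, ∀ᶠ t : ℕ in atTop,
        IsSeparated θ (D + 1) (combinatorialR M l k b) ((T κ)^[t] p) := by
    intro b p hp D
    obtain ⟨ξ, ζ, hξ, hζ, h⟩ := exists_solitonCount_of_incoming b hk hkl hθ hp
    rw [combinatorialR_apply]
    exact eventually_isSeparated b hk hkl hθ hfin hκ hξ hζ h D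
  constructor
  · intro hS
    funext b
    obtain ⟨p, hp⟩ := exists_isSeparated hθ (6 * l) b
    obtain ⟨t, h1, h2⟩ := ((key b p hp 0).and ((hS b p hp).1 1)).exists
    exact h2.label_eq hθ le_rfl le_rfl h1
  · rintro rfl b p hp
    refine ⟨fun D => (key b p hp D).mono fun t h => h.mono (Nat.le_succ D), fun t c hc => ?_⟩
    -- An outgoing label is the image of some `z`, so the state at time `t` has the tau function of
    -- `z`. Its later label is the image of `z` and also the image of `b`.
    obtain ⟨z, rfl⟩ := (combinatorialR M l k).surjective c
    rw [combinatorialR_apply z] at hc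
    obtain ⟨ξ, ζ, hξ, hζ, h⟩ := exists_solitonCount_of_outgoing z hk hkl hθ hc
    have h1 := eventually_isSeparated z hk hkl hθ hfin hκ hξ hζ h 0
    have h2 := (tendsto_add_atTop_nat t).eventually (key b p hp 0)
    obtain ⟨s, h3, h4⟩ := (h1.and h2).exists
    rw [← Function.iterate_add_apply] at h3
    rw [combinatorialR_apply z]
    exact h3.label_eq hθ le_rfl le_rfl h4

end Automaton

theorem theorem3p7 (l : ℕ) :
    ∃ K D : ℕ, ∀ (M : ℕ) [NeZero M] (k : ℕ), 0 < k → k < l →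
      ∀ θ : ℤ → ℕ, (∀ n, 0 < θ n) → {n : ℤ | l ≤ θ n}.Finite →
        ∀ κ : ℕ, K ≤ κ →
          (∀ R' : RowCrystal M l × RowCrystal M k ≃ RowCrystal M k × RowCrystal M l,
            RowCrystal.IsCrystalIso R' ↔ R' = RowCrystal.combinatorialR M l k) ∧
          ∀ S' : RowCrystal M l × RowCrystal M k → RowCrystal M k × RowCrystal M l,
            Automaton.IsScatteringMatrix θ κ D S' ↔ S' = RowCrystal.combinatorialR M l k :=
  -- A carrier of capacity `2 * l` has room for all `l + k` letters of both solitons.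
  ⟨2 * l, 6 * l, fun _ _ _ hk hkl _ hθ hfin _ hκ =>
    ⟨RowCrystal.isCrystalIso_iff (hk.trans hkl) hk,
      Automaton.isScatteringMatrix_iff hk hkl hθ hfin hκ⟩⟩
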